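/- For $N\ge 1$ let $X_N$ be the $N\times N$ random Vandermonde matrix whose $(i,j)$-th entry is $N^{-1/2}\zeta_i^{\,j}$ ($1\le i,j\le N$), where $\zeta_1,\dots,\zeta_N$ are independent random variables uniformly distributed (with respect to Haar measure) on the unit circle in $\mathbb{C}$. Let $\mathbb{E}$ denote expectation (taken entrywise on random matrices), let $\operatorname{tr}=\frac1N\operatorname{Tr}$ be the normalized trace, and let $\operatorname{diag}(A)$ be the diagonal matrix with the same diagonal entries as $A$. For $n\ge 1$ and $\epsilon=(\epsilon_1,\dots,\epsilon_n)\in\{1,*\}^n$, the maximal alternating interval partition $\sigma=\sigma(\epsilon)$ is the partition of $\{1,\dots,n\}$ whose blocks are the maximal intervals $I\subseteq\{1,\dots,n\}$ such that $\epsilon_j\ne\epsilon_{j+1}$ whenever $j\in I$ and $j+1\in I$. Proposition. For every $n\ge 1$ there is a constant $C$, depending only on $n$, such that for all $\epsilon_1,\dots,\epsilon_n\in\{1,*\}$, all $N\ge 1$ and all deterministic complex diagonal $N\times N$ matrices $d_1,\dots,d_n$ of operator norm at most $1$, \[ \left|\mathbb{E}\circ\operatorname{tr}\prod_{I\in\sigma}\left(\prod_{k\in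 I}d_kX_N^{\epsilon_k}-\mathbb{E}\circ\operatorname{diag}\left(\prod_{k\in I}d_kX_N^{\epsilon_k}\right)\right)\right|\le\frac{C}{\sqrt N}, \] where all products are taken in order of increasing indices (the product over $I\in\sigma$ in increasing order of the interval blocks). -/

import Mathlib

open MeasureTheory ProbabilityTheory

noncomputable section

namespace RandomVandermonde

/-! ### The maximal alternating interval partition

A word `ε ∈ {1, *}ⁿ` is encoded as `ε : Fin n → Bool`, where `false` stands for `1` and `true`
stands for `*`; the index set `{1, …, n}` is encoded as `Fin n`. -/

/-- `I` is a nonempty interval of indices along which `ε` alternates: whenever `j` and `j + 1`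
both lie in `I`, one has `ε j ≠ ε (j + 1)`. -/
def IsAltInterval {n : ℕ} (ε : Fin n → Bool) (I : Finset (Fin n)) : Prop :=
  I.Nonempty ∧ (∀ a ∈ I, ∀ c ∈ I, ∀ b, a ≤ b → b ≤ c → b ∈ I) ∧
    ∀ i ∈ I, ∀ j ∈ I, (j : ℕ) = i + 1 → ε i ≠ ε j

theorem IsAltInterval.union {n : ℕ} {ε : Fin n → Bool} {I J : Finset (Fin n)}
    (hI : IsAltInterval ε I) (hJ : IsAltInterval ε J) {k : Fin n} (hkI : k ∈ I) (hkJ : k ∈ J) :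
    IsAltInterval ε (I ∪ J) := by
  obtain ⟨-, hI1, hI2⟩ := hI
  obtain ⟨-, hJ1, hJ2⟩ := hJ
  refine ⟨⟨k, by simp [hkI]⟩, ?_, ?_⟩
  · intro a ha c hc b hab hbc
    rcases le_total b k with hbk | hkb
    · rcases Finset.mem_union.1 ha with ha | ha
      · exact Finset.mem_union_left _ (hI1 a ha k hkI b hab hbk)
      · exact Finset.mem_union_right _ (hJ1 a ha k hkJ b hab hbk)
    · rcases Finset.mem_union.1 hc with hc | hc
      · exact Finset.mem_union_left _ (hI1 k hkI c hc b hkb hbc)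
      · exact Finset.mem_union_right _ (hJ1 k hkJ c hc b hkb hbc)
  · intro i hi j hj hij
    have hlt : i ≤ j := Fin.le_def.2 (by omega)
    rcases le_or_gt j k with hjk | hkj
    · rcases Finset.mem_union.1 hi with hi | hi
      · exact hI2 i hi j (hI1 i hi k hkI j hlt hjk) hij
      · exact hJ2 i hi j (hJ1 i hi k hkJ j hlt hjk) hij
    · have hki : k ≤ i := Fin.le_def.2 (by have := Fin.lt_def.1 hkj; omega)
      rcases Finset.mem_union.1 hj with hj | hj
      · exact hI2 i (hI1 k hkI j hj i hki hlt) j hj hij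
      · exact hJ2 i (hJ1 k hkJ j hj i hki hlt) j hj hij

theorem isAltInterval_singleton {n : ℕ} (ε : Fin n → Bool) (k : Fin n) :
    IsAltInterval ε {k} := by
  refine ⟨Finset.singleton_nonempty k, ?_, ?_⟩
  · intro a ha c hc b hab hbc
    rw [Finset.mem_singleton] at ha hc ⊢
    subst ha
    subst hc
    exact le_antisymm hbc hab
  · intro i hi j hj hij
    rw [Finset.mem_singleton] at hi hj
    subst hi
    subst hj
    omega

open Classical in
/-- The maximal alternating interval partition `σ(ε)`: its blocks are the maximal (with respect
to inclusion) intervals along which `ε` alternates. -/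
def maxAltPartition {n : ℕ} (ε : Fin n → Bool) :
    Finpartition (Finset.univ : Finset (Fin n)) where
  parts := Finset.univ.filter fun I => Maximal (IsAltInterval ε) I
  supIndep := by
    rw [Finset.supIndep_iff_pairwiseDisjoint]
    intro I hI J hJ hIJ
    have hI' : Maximal (IsAltInterval ε) I := by simpa using hI
    have hJ' : Maximal (IsAltInterval ε) J := by simpa using hJ
    refine Finset.disjoint_left.2 fun k hkI hkJ => hIJ ?_
    have hU := hI'.prop.union hJ'.prop hkI hkJ
    exact (hI'.eq_of_le hU Finset.subset_union_left).trans
      (hJ'.eq_of_le hU Finset.subset_union_right).symm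
  sup_parts := by
    refine Finset.eq_univ_of_forall fun k => ?_
    obtain ⟨I, hkI, hI⟩ :=
      (Set.toFinite {I | IsAltInterval ε I}).exists_le_maximal (isAltInterval_singleton ε k)
    exact Finset.mem_sup.2 ⟨I, by simpa using hI, hkI (Finset.mem_singleton_self k)⟩
  bot_notMem := by
    intro h
    have h' : Maximal (IsAltInterval ε) (⊥ : Finset (Fin n)) := by simpa using h
    exact Finset.not_nonempty_empty h'.prop.1

/-- The first elements of the blocks of a partition. -/
def blockStarts {n : ℕ} (σ : Finpartition (Finset.univ : Finset (Fin n))) : Finset (Fin n) :=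
  Finset.univ.filter fun k => ∀ j ∈ σ.part k, k ≤ j

/-- The blocks of a partition, each occurring once, listed by increasing first element.
For an interval partition this is the increasing order of the blocks. -/
def blockList {n : ℕ} (σ : Finpartition (Finset.univ : Finset (Fin n))) :
    List (Finset (Fin n)) :=
  (blockStarts σ).sort.map σ.part

/-! ### Random Vandermonde matrices -/

/-- The Borel σ-algebra on the unit circle. -/
instance instMeasurableSpaceCircle : MeasurableSpace Circle := borel Circle

instance instBorelSpaceCircle : BorelSpace Circle := ⟨rfl⟩

/-- The uniform distribution on the unit circle: Haar measure of total mass one. -/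
def uniformCircle : Measure Circle := Measure.haarMeasure ⊤

/-- The normalized `N × N` Vandermonde matrix of `z₁, …, z_N`, with `(i, j)` entry
`N ^ (-1/2) * z_i ^ j` for `i, j ∈ {1, …, N}` (so the exponent is `j + 1` for `j : Fin N`). -/
def vandermonde {N : ℕ} (z : Fin N → Circle) : Matrix (Fin N) (Fin N) ℂ :=
  Matrix.of fun i j => ((√(N : ℝ) : ℝ) : ℂ)⁻¹ * (z i : ℂ) ^ ((j : ℕ) + 1)

/-- `X ^ e` for `e ∈ {1, *}`. -/
def starPow {N : ℕ} (X : Matrix (Fin N) (Fin N) ℂ) (e : Bool) : Matrix (Fin N) (Fin N) ℂ :=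
  if e then X.conjTranspose else X

/-- The word `∏_{k ∈ I} d_k X ^ {ε_k}`, with factors in increasing order of `k`. -/
def blockWord {n N : ℕ} (ε : Fin n → Bool) (d : Fin n → Matrix (Fin N) (Fin N) ℂ)
    (X : Matrix (Fin N) (Fin N) ℂ) (I : Finset (Fin n)) : Matrix (Fin N) (Fin N) ℂ :=
  (I.sort.map fun k => d k * starPow X (ε k)).prod

/-- `𝔼 ∘ diag`: the deterministic diagonal matrix of the expectations of the diagonal entries
of a random matrix. -/
def expDiag {N : ℕ} {Ω : Type*} [MeasurableSpace Ω] (P : Measure Ω)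
    (A : Ω → Matrix (Fin N) (Fin N) ℂ) : Matrix (Fin N) (Fin N) ℂ :=
  Matrix.diagonal fun i => ∫ ω, A ω i i ∂P

/-- The normalized trace. -/
def normTr {N : ℕ} (A : Matrix (Fin N) (Fin N) ℂ) : ℂ := (N : ℂ)⁻¹ * A.trace

/-- The random matrix `∏_{I ∈ σ(ε)} (∏_{k ∈ I} d_k X^{ε_k} - 𝔼 ∘ diag (∏_{k ∈ I} d_k X^{ε_k}))`,
with all products taken in increasing order. -/
def centeredProd {n N : ℕ} {Ω : Type*} [MeasurableSpace Ω] (P : Measure Ω)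
    (ε : Fin n → Bool) (d : Fin n → Matrix (Fin N) (Fin N) ℂ)
    (X : Ω → Matrix (Fin N) (Fin N) ℂ) (ω : Ω) : Matrix (Fin N) (Fin N) ℂ :=
  ((blockList (maxAltPartition ε)).map fun I =>
    blockWord ε d (X ω) I - expDiag P fun ω' => blockWord ε d (X ω') I).prod

end RandomVandermonde

end

/-! Write n = m + 1 and expand the trace over closed walks `i` of length n. Up to a deterministic
factor of modulus at most N^(-1/2) per letter, the block starting at `s` contributes a Laurent
monomial in the ζ_v, minus 1 when that monomial is trivial and the ends `i s` and `i (blockLast ε s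
+ 1)` coincide. Nontrivial monomials have mean zero, so the expectation vanishes unless the total
exponent is zero and no block has both a trivial monomial and equal ends; this is `IsContributing`.
It suffices that there are O(N^((n+1)/2)) such walks, because N^(-1) · N^(-n/2) · N^((n+1)/2) =
N^(-1/2).

For the count, fix which letters use the same row of X; there are boundedly many such patterns.
Within a pattern the exponent equations are linear in the walk, so there are at most N^D walks,
where D = dim `solutionSpace`. Rank-nullity gives D ≤ #`nonRowPos` + dim `relationSpace`. A non-row
position is a cyclic switch from 1 to *; there are as many switches back, and every block start
other than 0 is a non-switch, whence 2 #`nonRowPos` + #blocks ≤ n + 1.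

It remains to see that 2 dim `relationSpace` ≤ #blocks, and here the centering enters. A relation is
constant on each block and agrees on blocks that share a row. A block that shares no row with
another has a trivial monomial, hence distinct ends, and this forces every relation to vanish on the
cyclically next block (`relationSpace_eq_zero_of_isolated`). So each block yields a redundant
coordinate, and `two_mul_finrank_le_card` concludes. -/

namespace RandomVandermonde

/-! ### Dimension bounds for subspaces of coordinate spaces. -/

section LinearAlgebra

open Module

/-- The coordinate functional `x ↦ x i` on a space of functions. -/
def coordOn {ι : Type*} (V : Submodule ℚ (ι → ℚ)) (i : ι) : Module.Dual ℚ V :=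
  (LinearMap.proj i).comp V.subtype

/-- The coordinate functionals separate the points of V, so they span its dual, and a basis can be
extracted from them. -/
theorem exists_coordinate_basis {ι : Type*} [Fintype ι] (V : Submodule ℚ (ι → ℚ)) :
    ∃ F : Finset ι, F.card = finrank ℚ V ∧
      LinearIndependent ℚ (fun i : F => coordOn V i) ∧
      ∀ x ∈ V, (∀ i ∈ F, x i = 0) → x = 0 := by
  classical
  obtain ⟨κ, a, ha, hsp, hli⟩ := exists_linearIndependent' ℚ (coordOn V)
  have : Finite κ := Finite.of_injective a ha
  have := Fintype.ofFinite κ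
  have hzero : ∀ x : V, (∀ k, coordOn V (a k) x = 0) → x = 0 := by
    intro x hx
    have h1 : Submodule.span ℚ (Set.range (coordOn V)) ≤ LinearMap.ker (Dual.eval ℚ V x) := by
      rw [← hsp, Submodule.span_le]
      rintro _ ⟨k, rfl⟩
      exact hx k
    ext i
    exact h1 (Submodule.subset_span ⟨i, rfl⟩)
  have hspan : Submodule.span ℚ (Set.range (coordOn V ∘ a)) = ⊤ := by
    apply Submodule.eq_top_of_finrank_eq
    have h := Subspace.finrank_add_finrank_dualCoannihilator_eq
      (Submodule.span ℚ (Set.range (coordOn V ∘ a)))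
    have h0 : (Submodule.span ℚ (Set.range (coordOn V ∘ a))).dualCoannihilator = ⊥ := by
      rw [eq_bot_iff]
      intro x hx
      rw [Submodule.mem_dualCoannihilator] at hx
      exact hzero x fun k => hx _ (Submodule.subset_span ⟨k, rfl⟩)
    rw [h0, finrank_bot, add_zero] at h
    rw [h, Subspace.dual_finrank_eq]
  refine ⟨Finset.univ.map ⟨a, ha⟩, ?_, ?_, ?_⟩
  · rw [Finset.card_map, Finset.card_univ, ← finrank_span_eq_card hli, hspan, finrank_top,
      Subspace.dual_finrank_eq]
  · have hb : ∀ i : (Finset.univ.map ⟨a, ha⟩ : Finset ι), ∃ k, a k = i := fun i => by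
      obtain ⟨k, -, hk⟩ := Finset.mem_map.1 i.2
      exact ⟨k, hk⟩
    choose b hb using hb
    have hbinj : Function.Injective b := fun i j hij => Subtype.ext (by rw [← hb, ← hb, hij])
    have e : (fun i : (Finset.univ.map ⟨a, ha⟩ : Finset ι) => coordOn V i) =
        (coordOn V ∘ a) ∘ b := funext fun i => by simp [hb]
    rw [e]
    exact hli.comp b hbinj
  · intro x hx h
    exact congrArg Subtype.val (hzero ⟨x, hx⟩ fun k => h (a k) (by simp))

theorem card_le_pow_finrank {ι : Type*} [Fintype ι] [DecidableEq ι] {N : ℕ}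
    (V : Submodule ℚ (ι → ℚ)) {f : Fin N → ℚ} (hf : Function.Injective f)
    (S : Finset (ι → Fin N)) (hS : ∀ i ∈ S, f ∘ i ∈ V) : S.card ≤ N ^ finrank ℚ V := by
  obtain ⟨F, hF, -, hinj⟩ := exists_coordinate_basis V
  have h := Finset.card_le_card_of_injOn (s := S) (t := (Finset.univ : Finset (F → Fin N)))
    (fun i k => i k) (fun _ _ => by simp) (by
      intro i hi j hj hij
      have := hinj (f ∘ i - f ∘ j) (V.sub_mem (hS i hi) (hS j hj)) (fun k hk => by
        have := congrFun hij ⟨k, hk⟩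
        simp only at this
        simp [this])
      funext k
      exact hf (sub_eq_zero.1 (congrFun this k)))
  simpa [hF] using h

/-- Take a coordinate basis F. Each index in F has either a twin with the same coordinate functional
or an image under τ with zero functional; by independence neither lies in F. This gives an injection
from F into its complement. -/
theorem two_mul_finrank_le_card {ι : Type*} [Fintype ι] (K : Submodule ℚ (ι → ℚ))
    (τ : ι → ι) (hτ : Function.Injective τ)
    (h : ∀ i, (∃ j ≠ i, ∀ g ∈ K, g i = g j) ∨ ∀ g ∈ K, g (τ i) = 0) :
    2 * finrank ℚ K ≤ Fintype.card ι := by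
  classical
  obtain ⟨F, hF, hli, -⟩ := exists_coordinate_basis K
  have hne : ∀ i ∈ F, coordOn K i ≠ 0 := fun i hi => hli.ne_zero ⟨i, hi⟩
  have hinj : ∀ i ∈ F, ∀ j ∈ F, coordOn K i = coordOn K j → i = j := fun i hi j hj hij =>
    congrArg Subtype.val (hli.injective (a₁ := ⟨i, hi⟩) (a₂ := ⟨j, hj⟩) hij)
  have h' : ∀ i, ∃ j, (j ≠ i ∧ coordOn K j = coordOn K i) ∨ (j = τ i ∧ coordOn K j = 0) := by
    intro i
    rcases h i with ⟨j, hj, hg⟩ | hg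
    · exact ⟨j, Or.inl ⟨hj, LinearMap.ext fun g => (hg g g.2).symm⟩⟩
    · exact ⟨τ i, Or.inr ⟨rfl, LinearMap.ext fun g => hg g g.2⟩⟩
  choose φ hφ using h'
  have hcard : F.card ≤ Fᶜ.card := by
    refine Finset.card_le_card_of_injOn φ ?_ ?_
    · intro i hi
      have hi : i ∈ F := hi
      simp only [Finset.coe_compl, Set.mem_compl_iff, Finset.mem_coe]
      intro hφi
      rcases hφ i with ⟨h1, h2⟩ | ⟨-, h2⟩
      · exact h1 (hinj _ hφi _ hi h2)
      · exact hne _ hφi h2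
    · intro i hi j hj hij
      have hi : i ∈ F := hi
      have hj : j ∈ F := hj
      rcases hφ i with ⟨-, h1⟩ | ⟨h1, h1'⟩ <;> rcases hφ j with ⟨-, h2⟩ | ⟨h2, h2'⟩
      · exact hinj _ hi _ hj (by rw [← h1, ← h2, hij])
      · exact absurd (by rw [← h1, hij, h2']) (hne i hi)
      · exact absurd (by rw [← h2, ← hij, h1']) (hne j hj)
      · exact hτ (by rw [← h1, ← h2, hij])
  rw [Finset.card_compl] at hcard
  have := F.card_le_univ
  omega

/-- Rank-nullity on both sides of the pairing, since `f` and `f.flip` have the same rank. -/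
theorem finrank_ker_add_eq {U W : Type*} [AddCommGroup U] [Module ℚ U] [FiniteDimensional ℚ U]
    [AddCommGroup W] [Module ℚ W] [FiniteDimensional ℚ W] (f : U →ₗ[ℚ] W →ₗ[ℚ] ℚ) :
    finrank ℚ (LinearMap.ker f) + finrank ℚ W = finrank ℚ U + finrank ℚ (LinearMap.ker f.flip) := by
  have h1 := f.finrank_range_add_finrank_ker
  have h2 := f.flip.finrank_range_add_finrank_ker
  have h3 : finrank ℚ (LinearMap.range f.flip) = finrank ℚ (LinearMap.range f) := by
    rw [← LinearMap.finrank_range_dualMap_eq_finrank_range f]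
    have : f.flip = f.dualMap.comp (Module.evalEquiv ℚ W).toLinearMap := by
      ext; rfl
    rw [this, LinearMap.range_comp_of_range_eq_top _ (LinearEquiv.range _)]
  omega

end LinearAlgebra

/-! ### Combinatorics of the maximal alternating blocks. -/

section Blocks

variable {m : ℕ} (ε : Fin (m + 1) → Bool)

theorem maximal_part (k : Fin (m + 1)) :
    Maximal (IsAltInterval ε) ((maxAltPartition ε).part k) := by
  have h : (maxAltPartition ε).part k ∈ (maxAltPartition ε).parts :=
    (maxAltPartition ε).part_mem.2 (Finset.mem_univ k)
  simpa [maxAltPartition] using h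

theorem mem_part_self (k : Fin (m + 1)) : k ∈ (maxAltPartition ε).part k :=
  (maxAltPartition ε).mem_part (Finset.mem_univ k)

theorem part_eq_of_mem {j k : Fin (m + 1)} (h : j ∈ (maxAltPartition ε).part k) :
    (maxAltPartition ε).part j = (maxAltPartition ε).part k :=
  (maxAltPartition ε).part_eq_of_mem ((maxAltPartition ε).part_mem.2 (Finset.mem_univ k)) h

theorem mem_part_of_between {a b c k : Fin (m + 1)} (ha : a ∈ (maxAltPartition ε).part k)
    (hc : c ∈ (maxAltPartition ε).part k) (hab : a ≤ b) (hbc : b ≤ c) :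
    b ∈ (maxAltPartition ε).part k :=
  (maximal_part ε k).prop.2.1 a ha c hc b hab hbc

theorem ne_of_mem_part {a b k : Fin (m + 1)} (ha : a ∈ (maxAltPartition ε).part k)
    (hb : b ∈ (maxAltPartition ε).part k) (hab : (b : ℕ) = a + 1) : ε a ≠ ε b :=
  (maximal_part ε k).prop.2.2 a ha b hb hab

theorem part_eq_of_ne {a b : Fin (m + 1)} (hab : (b : ℕ) = a + 1) (h : ε a ≠ ε b) :
    (maxAltPartition ε).part a = (maxAltPartition ε).part b := by
  have hI : IsAltInterval ε {a, b} := by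
    refine ⟨⟨a, by simp⟩, ?_, ?_⟩
    · intro x hx y hy z hxz hzy
      simp only [Finset.mem_insert, Finset.mem_singleton] at hx hy ⊢
      rw [Fin.le_def] at hxz hzy
      simp only [Fin.ext_iff] at *
      omega
    · intro x hx y hy hxy
      simp only [Finset.mem_insert, Finset.mem_singleton] at hx hy
      rcases hx with rfl | rfl <;> rcases hy with rfl | rfl
      · omega
      · exact h
      · omega
      · omega
  have hU := (maximal_part ε a).prop.union hI (mem_part_self ε a) (by simp)
  have := (maximal_part ε a).eq_of_le hU Finset.subset_union_left
  refine (part_eq_of_mem ε ?_).symm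
  rw [this]
  simp

/-- The last element of the block containing `k`. -/
noncomputable def blockLast (k : Fin (m + 1)) : Fin (m + 1) :=
  ((maxAltPartition ε).part k).max' ⟨k, mem_part_self ε k⟩

theorem blockLast_mem (k : Fin (m + 1)) : blockLast ε k ∈ (maxAltPartition ε).part k :=
  Finset.max'_mem _ _

theorem le_blockLast {j k : Fin (m + 1)} (h : j ∈ (maxAltPartition ε).part k) :
    j ≤ blockLast ε k :=
  Finset.le_max' _ _ h

theorem mem_blockStarts {σ : Finpartition (Finset.univ : Finset (Fin (m + 1)))}
    {k : Fin (m + 1)} : k ∈ blockStarts σ ↔ ∀ j ∈ σ.part k, k ≤ j := by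
  simp [blockStarts]

theorem part_eq_Icc {s : Fin (m + 1)} (hs : s ∈ blockStarts (maxAltPartition ε)) :
    (maxAltPartition ε).part s = Finset.Icc s (blockLast ε s) := by
  ext k
  rw [Finset.mem_Icc]
  refine ⟨fun h => ⟨mem_blockStarts.1 hs k h, le_blockLast ε h⟩, fun h => ?_⟩
  exact mem_part_of_between ε (mem_part_self ε s) (blockLast_mem ε s) h.1 h.2

theorem eq_of_mem_blockStarts {a s : Fin (m + 1)} (hs : s ∈ blockStarts (maxAltPartition ε))
    (has : (s : ℕ) = a + 1) : ε a = ε s := by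
  by_contra h
  have h1 := part_eq_of_ne ε has h
  have := mem_blockStarts.1 hs a (h1 ▸ mem_part_self ε a)
  rw [Fin.le_def] at this
  omega

theorem eq_blockLast_succ {k b : Fin (m + 1)} (hb : (b : ℕ) = blockLast ε k + 1) :
    ε (blockLast ε k) = ε b := by
  by_contra h
  have h1 := part_eq_of_ne ε hb h
  rw [part_eq_of_mem ε (blockLast_mem ε k)] at h1
  have := le_blockLast ε (k := k) (h1 ▸ mem_part_self ε b)
  rw [Fin.le_def] at this
  omega

theorem val_add_one_of_ne_zero {k : Fin (m + 1)} (h : k + 1 ≠ 0) :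
    ((k + 1 : Fin (m + 1)) : ℕ) = k + 1 := by
  rw [Fin.val_add_one]
  split_ifs with hk
  · subst hk
    simp at h
  · rfl

/-- The successor is cyclic: after the last block it is 0, which is also a block start. Thus "next
block" is a permutation of the blocks. -/
theorem blockLast_add_one_mem (k : Fin (m + 1)) :
    blockLast ε k + 1 ∈ blockStarts (maxAltPartition ε) := by
  rw [mem_blockStarts]
  intro j hj
  by_cases h0 : blockLast ε k + 1 = 0
  · rw [h0]; exact Fin.zero_le j
  have hv := val_add_one_of_ne_zero h0
  by_contra hlt
  rw [Fin.le_def] at hlt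
  have h1 : blockLast ε k ∈ (maxAltPartition ε).part (blockLast ε k + 1) :=
    mem_part_of_between ε hj (mem_part_self ε _) (Fin.le_def.2 (by omega))
      (Fin.le_def.2 (by omega))
  have h2 := part_eq_of_mem ε h1
  rw [part_eq_of_mem ε (blockLast_mem ε k)] at h2
  have := le_blockLast ε (k := k) (h2 ▸ mem_part_self ε (blockLast ε k + 1))
  rw [Fin.le_def] at this
  omega

theorem blockLast_injOn {s t : Fin (m + 1)} (hs : s ∈ blockStarts (maxAltPartition ε))
    (ht : t ∈ blockStarts (maxAltPartition ε)) (h : blockLast ε s = blockLast ε t) : s = t := by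
  have h1 : (maxAltPartition ε).part s = (maxAltPartition ε).part t := by
    rw [← part_eq_of_mem ε (blockLast_mem ε s), h, part_eq_of_mem ε (blockLast_mem ε t)]
  exact le_antisymm (mem_blockStarts.1 hs t (h1 ▸ mem_part_self ε t))
    (mem_blockStarts.1 ht s (h1 ▸ mem_part_self ε s))

theorem exists_blockStart (k : Fin (m + 1)) :
    ∃ s ∈ blockStarts (maxAltPartition ε), k ∈ (maxAltPartition ε).part s := by
  have hmem := Finset.min'_mem ((maxAltPartition ε).part k) ⟨k, mem_part_self ε k⟩
  have h := part_eq_of_mem ε hmem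
  refine ⟨_, ?_, h ▸ mem_part_self ε k⟩
  rw [mem_blockStarts, h]
  exact fun j hj => Finset.min'_le _ _ hj

theorem eq_on_part {α : Type*} {g : Fin (m + 1) → α}
    (hg : ∀ a b : Fin (m + 1), (b : ℕ) = a + 1 → ε a ≠ ε b → g a = g b)
    {s k : Fin (m + 1)} (hs : s ∈ blockStarts (maxAltPartition ε))
    (hk : k ∈ (maxAltPartition ε).part s) : g k = g s := by
  have hsk := mem_blockStarts.1 hs k hk
  obtain ⟨d, hd⟩ : ∃ d, (k : ℕ) = s + d := ⟨k - s, by rw [Fin.le_def] at hsk; omega⟩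
  induction d generalizing k with
  | zero => rw [Fin.ext (a := k) (b := s) (by omega)]
  | succ d ih =>
    let a : Fin (m + 1) := ⟨s + d, by have := k.2; omega⟩
    have ha : a ∈ (maxAltPartition ε).part s :=
      mem_part_of_between ε (mem_part_self ε s) hk (Fin.le_def.2 (by simp [a]))
        (Fin.le_def.2 (by simp [a]; omega))
    have hak : (k : ℕ) = a + 1 := by simp [a]; omega
    rw [← ih ha (mem_blockStarts.1 hs a ha) rfl, hg a k hak (ne_of_mem_part ε ha hk hak)]

/-- The index, in the word, of the row of `X` used by the `k`-th letter. -/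
def rowPos (k : Fin (m + 1)) : Fin (m + 1) := if ε k then k + 1 else k

/-- The index, in the word, of the column of `X` used by the `k`-th letter. -/
def colPos (k : Fin (m + 1)) : Fin (m + 1) := if ε k then k else k + 1

/-- The sign of the exponent contributed by the `k`-th letter. -/
def letterSign (k : Fin (m + 1)) : ℤ := if ε k then -1 else 1

/-- Adjacent letters 1, * share a column position and have opposite signs, so they cancel; only
columns at the two ends survive. -/
theorem sum_Icc_alternating (h : Fin (m + 1) → ℤ) {s t : Fin (m + 1)} (hst : s ≤ t)
    (halt : ∀ a b : Fin (m + 1), s ≤ a → b ≤ t → (b : ℕ) = a + 1 → ε a ≠ ε b) :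
    ∑ k ∈ Finset.Icc s t, letterSign ε k * h (colPos ε k) =
      (if ε t then 0 else h (t + 1)) - if ε s then h s else 0 := by
  obtain ⟨d, hd⟩ : ∃ d, (t : ℕ) = s + d := ⟨t - s, by rw [Fin.le_def] at hst; omega⟩
  induction d generalizing t with
  | zero =>
    obtain rfl : t = s := Fin.ext (by omega)
    cases hε : ε t <;> simp [letterSign, colPos, hε]
  | succ d ih =>
    let a : Fin (m + 1) := ⟨s + d, by have := t.2; omega⟩
    have ha : (t : ℕ) = a + 1 := by simp [a]; omega
    have hsa : s ≤ a := Fin.le_def.2 (by simp [a])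
    have hat : a + 1 = t := by
      apply Fin.ext
      rw [Fin.val_add_one, if_neg, ha]
      intro h'
      have := congrArg Fin.val h'
      have := t.2
      simp at *
      omega
    have hI : Finset.Icc s t = insert t (Finset.Icc s a) := by
      ext k
      simp only [Finset.mem_insert, Finset.mem_Icc, Fin.le_def, Fin.ext_iff]
      rw [Fin.le_def] at hst
      omega
    have hnot : t ∉ Finset.Icc s a := by
      simp only [Finset.mem_Icc, Fin.le_def]
      omega
    rw [hI, Finset.sum_insert hnot, ih hsa (fun x y hx hy => halt x y hx
      (hy.trans (Fin.le_def.2 (by omega)))) rfl, hat]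
    have hne := halt a t hsa le_rfl ha
    cases h1 : ε a <;> cases h2 : ε t <;> simp_all [letterSign, colPos] <;> ring

end Blocks

/-! ### Counting the contributing walks. -/

section Counting

open Module

variable {m N : ℕ} (ε : Fin (m + 1) → Bool)

/-- The exponent of the `v`-th variable in the product of the letters in `J`, along the closed
walk `i`. -/
def exponentAt (i : Fin (m + 1) → Fin N) (J : Finset (Fin (m + 1))) (v : Fin N) : ℤ :=
  ∑ k ∈ J with i (rowPos ε k) = v, letterSign ε k * ((i (colPos ε k) : ℕ) + 1)

/-- The walks that contribute to the expected trace of the centered product. -/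
def IsContributing (i : Fin (m + 1) → Fin N) : Prop :=
  (∀ v, exponentAt ε i Finset.univ v = 0) ∧ ∀ s ∈ blockStarts (maxAltPartition ε),
    (∀ v, exponentAt ε i ((maxAltPartition ε).part s) v = 0) → i s ≠ i (blockLast ε s + 1)

/-- The vectors indexed by positions that are constant on the row positions carrying the
same row. -/
def rowSpace (i : Fin (m + 1) → Fin N) : Submodule ℚ (Fin (m + 1) → ℚ) where
  carrier := {x | ∀ k l, i (rowPos ε k) = i (rowPos ε l) → x (rowPos ε k) = x (rowPos ε l)}
  add_mem' hx hy k l h := by simp only [Pi.add_apply, hx k l h, hy k l h]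
  zero_mem' _ _ _ := rfl
  smul_mem' c x hx k l h := by simp only [Pi.smul_apply, hx k l h]

/-- The vectors indexed by letters that are constant on the letters using the same row. -/
def classSpace (i : Fin (m + 1) → Fin N) : Submodule ℚ (Fin (m + 1) → ℚ) where
  carrier := {g | ∀ k l, i (rowPos ε k) = i (rowPos ε l) → g k = g l}
  add_mem' hx hy k l h := by simp only [Pi.add_apply, hx k l h, hy k l h]
  zero_mem' _ _ _ := rfl
  smul_mem' c x hx k l h := by simp only [Pi.smul_apply, hx k l h]

/-- The pairing of position vectors with letter vectors whose vanishing expresses the equations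
for the exponents. -/
def wordForm : (Fin (m + 1) → ℚ) →ₗ[ℚ] (Fin (m + 1) → ℚ) →ₗ[ℚ] ℚ :=
  LinearMap.mk₂ ℚ (fun x g => ∑ k, (letterSign ε k : ℚ) * x (colPos ε k) * g k)
    (fun x y g => by rw [← Finset.sum_add_distrib]; congr! 1; simp; ring)
    (fun c x g => by rw [smul_eq_mul, Finset.mul_sum]; congr! 1; simp; ring)
    (fun x g h => by rw [← Finset.sum_add_distrib]; congr! 1; simp; ring)
    (fun c x g => by rw [smul_eq_mul, Finset.mul_sum]; congr! 1; simp; ring)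

theorem wordForm_apply (x g : Fin (m + 1) → ℚ) :
    wordForm ε x g = ∑ k, (letterSign ε k : ℚ) * x (colPos ε k) * g k := rfl

/-- The position vectors satisfying the exponent equations. -/
noncomputable def solutionSpace (i : Fin (m + 1) → Fin N) : Submodule ℚ (Fin (m + 1) → ℚ) :=
  (LinearMap.ker ((wordForm ε).domRestrict₁₂ (rowSpace ε i) (classSpace ε i))).map
    (rowSpace ε i).subtype

/-- The linear relations between the exponent equations. -/
noncomputable def relationSpace (i : Fin (m + 1) → Fin N) : Submodule ℚ (Fin (m + 1) → ℚ) :=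
  (LinearMap.ker ((wordForm ε).domRestrict₁₂ (rowSpace ε i) (classSpace ε i)).flip).map
    (classSpace ε i).subtype

theorem mem_solutionSpace {i : Fin (m + 1) → Fin N} {x : Fin (m + 1) → ℚ} :
    x ∈ solutionSpace ε i ↔ x ∈ rowSpace ε i ∧ ∀ g ∈ classSpace ε i, wordForm ε x g = 0 := by
  simp only [solutionSpace, Submodule.mem_map, LinearMap.mem_ker, LinearMap.ext_iff,
    Subtype.forall]
  exact ⟨fun ⟨x, hx, h⟩ => h ▸ ⟨x.2, hx⟩, fun ⟨h, h'⟩ => ⟨⟨x, h⟩, h', rfl⟩⟩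

theorem mem_relationSpace {i : Fin (m + 1) → Fin N} {g : Fin (m + 1) → ℚ} :
    g ∈ relationSpace ε i ↔ g ∈ classSpace ε i ∧ ∀ x ∈ rowSpace ε i, wordForm ε x g = 0 := by
  simp only [relationSpace, Submodule.mem_map, LinearMap.mem_ker, LinearMap.ext_iff,
    Subtype.forall]
  exact ⟨fun ⟨x, hx, h⟩ => h ▸ ⟨x.2, hx⟩, fun ⟨h, h'⟩ => ⟨⟨g, h⟩, h', rfl⟩⟩

/-- A vector `g` constant on row classes is a function G of the row, so the pairing with `g` is the
sum over v of G v times the v-th exponent, which is zero. -/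
theorem mem_solutionSpace_of_isContributing {i j : Fin (m + 1) → Fin N}
    (hij : ∀ k l, i (rowPos ε k) = i (rowPos ε l) ↔ j (rowPos ε k) = j (rowPos ε l))
    (hj : IsContributing ε j) : (fun v : Fin N => ((v : ℕ) : ℚ) + 1) ∘ j ∈ solutionSpace ε i := by
  rw [mem_solutionSpace]
  refine ⟨fun k l h => ?_, fun g hg => ?_⟩
  · simp only [Function.comp, (hij k l).1 h]
  obtain ⟨G, hG⟩ : ∃ G : Fin N → ℚ, ∀ k, g k = G (j (rowPos ε k)) := by
    classical
    refine ⟨fun v => if h : ∃ k, j (rowPos ε k) = v then g h.choose else 0, fun k => ?_⟩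
    have h : ∃ l, j (rowPos ε l) = j (rowPos ε k) := ⟨k, rfl⟩
    simp only [dif_pos h]
    exact hg _ _ ((hij _ _).2 h.choose_spec.symm)
  rw [wordForm_apply, ← Finset.sum_fiberwise (g := fun k => j (rowPos ε k))]
  refine Finset.sum_eq_zero fun v _ => ?_
  have h := congrArg (fun z : ℤ => (z : ℚ) * G v) (hj.1 v)
  simp only [exponentAt, Int.cast_zero, zero_mul, Int.cast_sum, Finset.sum_mul] at h
  rw [← h]
  refine Finset.sum_congr rfl fun k hk => ?_
  rw [hG, (Finset.mem_filter.1 hk).2]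
  simp

/-- The positions that are not row positions. -/
def nonRowPos : Finset (Fin (m + 1)) := Finset.univ.filter fun p => ∀ k, rowPos ε k ≠ p

/-- A vector is determined by its values at row positions, which form a class vector, and its values
at the remaining positions. -/
theorem finrank_rowSpace_le (i : Fin (m + 1) → Fin N) :
    finrank ℚ (rowSpace ε i) ≤ finrank ℚ (classSpace ε i) + (nonRowPos ε).card := by
  let f : rowSpace ε i →ₗ[ℚ] classSpace ε i × (nonRowPos ε → ℚ) :=
    { toFun := fun x => (⟨fun k => (x : Fin (m + 1) → ℚ) (rowPos ε k), fun k l h => x.2 k l h⟩,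
        fun p => (x : Fin (m + 1) → ℚ) p)
      map_add' := fun x y => rfl
      map_smul' := fun c x => rfl }
  have hf : Function.Injective f := by
    intro x y hxy
    have h1 := congrArg (fun z => (z.1 : Fin (m + 1) → ℚ)) hxy
    have h2 := congrArg Prod.snd hxy
    ext p
    by_cases hp : ∃ k, rowPos ε k = p
    · obtain ⟨k, rfl⟩ := hp
      exact congrFun h1 k
    · exact congrFun h2 ⟨p, by simpa [nonRowPos] using hp⟩
  have := LinearMap.finrank_le_finrank_of_injective hf
  simpa [Module.finrank_prod] using this

theorem finrank_solutionSpace_le (i : Fin (m + 1) → Fin N) :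
    finrank ℚ (solutionSpace ε i) ≤ (nonRowPos ε).card + finrank ℚ (relationSpace ε i) := by
  have h1 := finrank_ker_add_eq ((wordForm ε).domRestrict₁₂ (rowSpace ε i) (classSpace ε i))
  have h2 := finrank_rowSpace_le ε i
  rw [solutionSpace, relationSpace, Submodule.finrank_map_subtype_eq,
    Submodule.finrank_map_subtype_eq]
  omega

theorem two_mul_card_nonRowPos_add_le :
    2 * (nonRowPos ε).card + (blockStarts (maxAltPartition ε)).card ≤ m + 2 := by
  have h1 : (nonRowPos ε).card ≤ (Finset.univ.filter fun k => ¬ ε k ∧ ε (k + 1)).card := by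
    refine (Finset.card_le_card ?_).trans (Finset.card_image_le (f := (· + 1)))
    intro p hp
    simp only [nonRowPos, Finset.mem_filter, Finset.mem_univ, true_and] at hp
    simp only [Finset.mem_image, Finset.mem_filter, Finset.mem_univ, true_and]
    refine ⟨p - 1, ⟨?_, ?_⟩, by simp⟩
    · intro h; exact hp (p - 1) (by simp [rowPos, h])
    · by_contra h; exact hp p (by simp_all [rowPos])
  have h2 : (blockStarts (maxAltPartition ε)).card ≤
      (Finset.univ.filter fun k => ε k = ε (k + 1)).card + 1 := by
    -- Position 0 starts a block even if the cyclic step into it alternates; this exception costs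
    -- the extra 1.
    refine (Finset.card_le_card (t := insert 0 ((Finset.univ.filter fun k =>
      ε k = ε (k + 1)).image (· + 1))) ?_).trans
      ((Finset.card_insert_le _ _).trans (Nat.add_le_add_right Finset.card_image_le 1))
    intro s hs
    rw [Finset.mem_insert]
    by_cases h0 : s = 0
    · exact Or.inl h0
    right
    simp only [Finset.mem_image, Finset.mem_filter, Finset.mem_univ, true_and]
    refine ⟨s - 1, ?_, by simp⟩
    have := eq_of_mem_blockStarts ε (a := s - 1) hs (by
      have := val_add_one_of_ne_zero (k := s - 1) (by simpa using h0)
      simpa using this)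
    simpa using this
  have h3 : (Finset.univ.filter fun k => ¬ ε k ∧ ε (k + 1)).card =
      (Finset.univ.filter fun k => ε k ∧ ¬ ε (k + 1)).card := by
    have h : (∑ k, if ε (k + 1) then 1 else 0) = ∑ k, if ε k then 1 else 0 :=
      Equiv.sum_comp (Equiv.addRight (1 : Fin (m + 1))) (fun k => if ε k then 1 else 0)
    have h' : ∀ k, ((if ¬ ε k ∧ ε (k + 1) then 1 else 0) + if ε k then 1 else 0) =
        (if ε k ∧ ¬ ε (k + 1) then 1 else 0) + if ε (k + 1) then 1 else 0 := by
      intro k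
      cases ε k <;> cases ε (k + 1) <;> simp
    have h'' := Finset.sum_congr (rfl : (Finset.univ : Finset (Fin (m + 1))) = _)
      (fun k _ => h' k)
    rw [Finset.sum_add_distrib, Finset.sum_add_distrib, h] at h''
    rw [Finset.card_filter, Finset.card_filter]
    exact Nat.add_right_cancel h''
  have h4 : (Finset.univ.filter fun k => ¬ ε k ∧ ε (k + 1)).card +
      (Finset.univ.filter fun k => ε k ∧ ¬ ε (k + 1)).card +
      (Finset.univ.filter fun k => ε k = ε (k + 1)).card = m + 1 := by
    rw [Finset.card_filter, Finset.card_filter, Finset.card_filter, ← Finset.sum_add_distrib,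
      ← Finset.sum_add_distrib, Finset.sum_congr rfl (g := fun _ => 1), Finset.sum_const]
    · simp
    · intro k _
      cases ε k <;> cases ε (k + 1) <;> simp
  omega

variable {ε}

theorem relationSpace_eq_of_ne {i : Fin (m + 1) → Fin N} {g : Fin (m + 1) → ℚ}
    (hg : g ∈ relationSpace ε i) {a b : Fin (m + 1)} (hab : (b : ℕ) = a + 1) (h : ε a ≠ ε b) :
    g a = g b := by
  rw [mem_relationSpace] at hg
  have hb : a + 1 = b := by
    apply Fin.ext
    rw [Fin.val_add_one, if_neg, hab]
    intro h'
    have := congrArg Fin.val h'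
    have := b.2
    simp at *
    omega
  have hne : a ≠ b := fun h' => h (by rw [h'])
  cases ha : ε a
  · have hb' : ε b = true := by simpa [ha] using h.symm
    -- Position `b` is the column of both letters and the row of none, so `rowSpace` leaves it free;
    -- testing against it gives `g a - g b = 0`.
    have h1 := hg.2 (Pi.single b 1) (by
      have : ∀ k, rowPos ε k ≠ b := by
        intro k hk
        cases hk' : ε k <;> simp only [rowPos, hk', if_true, if_false, Bool.false_eq_true] at hk
        · simp [hk, hb'] at hk'
        · rw [← hb, add_left_inj] at hk
          simp [hk, ha] at hk'
      intro k l _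
      simp [this])
    rw [wordForm_apply, Finset.sum_eq_add a b hne] at h1
    · simp [colPos, letterSign, ha, hb', hb] at h1
      linarith
    · intro k _ hk
      have : colPos ε k ≠ b := by
        intro hk2
        cases hk' : ε k <;> simp only [colPos, hk', if_true, if_false, Bool.false_eq_true] at hk2
        · rw [← hb, add_left_inj] at hk2
          exact hk.1 hk2
        · exact hk.2 hk2
      simp [this]
    · simp
    · simp
  · have hb' : ε b = false := by simpa [ha] using h.symm
    -- For * followed by 1 the two letters share their row position.
    refine hg.1 a b ?_
    simp [rowPos, ha, hb', hb]

/-- No other letter uses the rows of this block, so its own exponents vanish and its ends must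
differ. The row at the position after the block then occurs as a column only at the first letter of
the next block, up to non-row positions; testing against its indicator isolates the value of `g`
there. -/
theorem relationSpace_eq_zero_of_isolated {i : Fin (m + 1) → Fin N} (hi : IsContributing ε i)
    {g : Fin (m + 1) → ℚ} (hg : g ∈ relationSpace ε i) {s : Fin (m + 1)}
    (hs : s ∈ blockStarts (maxAltPartition ε))
    (hiso : ∀ k ∈ (maxAltPartition ε).part s, ∀ l ∉ (maxAltPartition ε).part s,
      i (rowPos ε k) ≠ i (rowPos ε l)) : g (blockLast ε s + 1) = 0 := by
  set J := (maxAltPartition ε).part s with hJ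
  set t := blockLast ε s with ht
  have htJ : t ∈ J := blockLast_mem ε s
  have hmult : ∀ v, exponentAt ε i J v = 0 := by
    intro v
    by_cases hv : ∃ k ∈ J, i (rowPos ε k) = v
    · obtain ⟨k, hk, rfl⟩ := hv
      rw [← hi.1 (i (rowPos ε k)), exponentAt, exponentAt]
      refine Finset.sum_congr ?_ fun _ _ => rfl
      ext l
      simp only [Finset.mem_filter, Finset.mem_univ, true_and, and_iff_right_iff_imp]
      intro hl
      by_contra hlJ
      exact hiso k hk l hlJ hl.symm
    · push Not at hv
      rw [exponentAt, Finset.filter_eq_empty_iff.2 (fun {k} hk => hv k hk), Finset.sum_empty]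
  have hends : i s ≠ i (t + 1) := hi.2 s hs hmult
  have hsum : ∑ k ∈ J, letterSign ε k * (((i (colPos ε k) : ℕ) : ℤ) + 1) = 0 := by
    rw [← Finset.sum_fiberwise (g := fun k => i (rowPos ε k))]
    exact Finset.sum_eq_zero fun v _ => hmult v
  have hle : s ≤ t := mem_blockStarts.1 hs t htJ
  have hIcc : J = Finset.Icc s t := part_eq_Icc ε hs
  rw [hIcc, sum_Icc_alternating ε (fun p => ((i p : ℕ) : ℤ) + 1) hle] at hsum
  swap
  · intro a b ha hb hab
    refine ne_of_mem_part ε (k := s) ?_ ?_ hab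
    · rw [← hJ, hIcc, Finset.mem_Icc]
      exact ⟨ha, Fin.le_def.2 (by rw [Fin.le_def] at hb; omega)⟩
    · rw [← hJ, hIcc, Finset.mem_Icc]
      exact ⟨Fin.le_def.2 (by rw [Fin.le_def] at ha; omega), hb⟩
  -- If the last letter were 1, the telescoped sum would be either `i (t + 1) + 1`, which is
  -- positive, or a difference whose vanishing makes the ends equal.
  have hεt : ε t = true := by
    by_contra h
    apply hends
    apply Fin.ext
    cases hs' : ε s <;> simp only [h, hs', if_true, if_false, Bool.false_eq_true] at hsum <;> omega
  set q := t + 1 with hq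
  have hrt : rowPos ε t = q := by simp [rowPos, hεt, hq]
  -- For `q = 0` maximality says nothing, as blocks do not wrap around; there a letter 1 at `q`
  -- would share the row of `t`, putting `q` in the block and making the ends equal.
  have hεq : ε q = true := by
    by_cases h0 : q = 0
    · by_contra h
      have hr : rowPos ε q = q := by simp [rowPos, h]
      have hqJ : q ∈ J := by
        by_contra hqJ
        exact hiso t htJ q hqJ (by rw [hrt, hr])
      have hsq := mem_blockStarts.1 hs q hqJ
      rw [h0] at hsq
      exact hends (by rw [h0, Fin.le_zero_iff.1 hsq])
    · rw [← eq_blockLast_succ ε (k := s) (val_add_one_of_ne_zero h0), ← ht, hεt]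
  rw [mem_relationSpace] at hg
  classical
  have h1 := hg.2 (fun p => if (∃ k, rowPos ε k = p) ∧ i p = i q then 1 else 0) (by
    intro k l hkl
    simp [hkl])
  rw [wordForm_apply, Finset.sum_eq_single q] at h1
  · have hc : colPos ε q = q := by simp [colPos, hεq]
    rw [hc, if_pos ⟨⟨t, hrt⟩, rfl⟩] at h1
    simpa [letterSign, hεq] using h1
  · intro k _ hkq
    rw [if_neg, mul_zero, zero_mul]
    -- A second occurrence makes the column of `k` the row of some `l` in the block, which forces `k
    -- = l`, equal adjacent letters inside the block, or equal ends.
    rintro ⟨⟨l, hl⟩, hk⟩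
    have hlJ : l ∈ J := by
      by_contra hlJ
      exact hiso t htJ l hlJ (by rw [hrt, hl, hk])
    cases hεk : ε k <;> cases hεl : ε l <;>
      simp only [rowPos, colPos, hεk, hεl, if_true, if_false, Bool.false_eq_true] at hl hk
    · by_cases hls : l = s
      · exact hends (by rw [← hls, hl, hk])
      · have hsl := mem_blockStarts.1 hs l hlJ
        have hl0 : k + 1 ≠ 0 := by
          rw [← hl]
          rintro rfl
          exact hls (Fin.le_zero_iff.1 hsl).symm
        have hv := val_add_one_of_ne_zero hl0
        rw [← hl] at hv
        have hsl' : s < l := lt_of_le_of_ne hsl (Ne.symm hls)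
        have hkJ : k ∈ J := mem_part_of_between ε (mem_part_self ε s) hlJ
          (Fin.le_def.2 (by rw [Fin.lt_def] at hsl'; omega)) (Fin.le_def.2 (by omega))
        exact ne_of_mem_part ε hkJ hlJ hv (by rw [hεk, hεl])
    · rw [add_left_inj] at hl
      simp [hl, hεk] at hεl
    · simp [hl, hεk] at hεl
    · have hlt : l ≠ t := by
        rintro rfl
        exact hkq hl.symm
      have hlt' : l < t := lt_of_le_of_ne (le_blockLast ε hlJ) hlt
      have hv : (k : ℕ) = l + 1 := by
        rw [← hl]
        apply val_add_one_of_ne_zero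
        intro h0
        have := congrArg Fin.val h0
        rw [Fin.val_add_one, if_neg] at this
        · simp at this
        · rintro rfl
          exact absurd (Fin.le_last t) (not_le.2 hlt')
      have hkJ : k ∈ J := mem_part_of_between ε hlJ htJ (Fin.le_def.2 (by omega))
        (Fin.le_def.2 (by rw [Fin.lt_def] at hlt'; omega))
      exact ne_of_mem_part ε hlJ hkJ hv (by rw [hεk, hεl])
  · simp

/-- Relations are viewed as functions on the set of blocks, with τ the passage to the next block. -/
theorem two_mul_finrank_relationSpace_le {i : Fin (m + 1) → Fin N} (hi : IsContributing ε i) :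
    2 * finrank ℚ (relationSpace ε i) ≤ (blockStarts (maxAltPartition ε)).card := by
  set S := blockStarts (maxAltPartition ε)
  let f : (Fin (m + 1) → ℚ) →ₗ[ℚ] (S → ℚ) := LinearMap.funLeft ℚ ℚ Subtype.val
  have hconst : ∀ g ∈ relationSpace ε i, ∀ s ∈ S, ∀ k ∈ (maxAltPartition ε).part s, g k = g s :=
    fun g hg s hs k hk => eq_on_part ε (fun a b => relationSpace_eq_of_ne hg) hs hk
  have hinj : Function.Injective (f.domRestrict (relationSpace ε i)) := by
    rw [← LinearMap.ker_eq_bot, LinearMap.ker_eq_bot']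
    intro g hg
    ext k
    obtain ⟨s, hs, hk⟩ := exists_blockStart ε k
    rw [hconst g g.2 s hs k hk]
    exact congrFun hg ⟨s, hs⟩
  rw [← LinearMap.finrank_range_of_inj hinj, LinearMap.range_domRestrict, ← Fintype.card_coe]
  refine two_mul_finrank_le_card _
    (fun s => ⟨blockLast ε s + 1, blockLast_add_one_mem ε s⟩) ?_ ?_
  · intro s t hst
    simp only [Subtype.mk.injEq, add_left_inj] at hst
    exact Subtype.ext (blockLast_injOn ε s.2 t.2 hst)
  · rintro ⟨s, hs⟩
    by_cases hiso : ∀ k ∈ (maxAltPartition ε).part s, ∀ l ∉ (maxAltPartition ε).part s,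
      i (rowPos ε k) ≠ i (rowPos ε l)
    · right
      rintro _ ⟨g, hg, rfl⟩
      exact relationSpace_eq_zero_of_isolated hi hg hs hiso
    · left
      push Not at hiso
      obtain ⟨k, hk, l, hl, hkl⟩ := hiso
      obtain ⟨t, ht, hlt⟩ := exists_blockStart ε l
      refine ⟨⟨t, ht⟩, ?_, ?_⟩
      · intro h
        obtain rfl : t = s := congrArg Subtype.val h
        exact hl hlt
      · rintro _ ⟨g, hg, rfl⟩
        change g s = g t
        rw [← hconst g hg s hs k hk, ← hconst g hg t ht l hlt]
        exact ((mem_relationSpace ε).1 hg).1 k l hkl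

theorem two_mul_finrank_solutionSpace_le {i : Fin (m + 1) → Fin N} (hi : IsContributing ε i) :
    2 * finrank ℚ (solutionSpace ε i) ≤ m + 2 := by
  have h1 := finrank_solutionSpace_le ε i
  have h2 := two_mul_finrank_relationSpace_le hi
  have h3 := two_mul_card_nonRowPos_add_le ε
  omega

variable (ε)

open Classical in
theorem card_isContributing_le (hN : 1 ≤ N) :
    ((Finset.univ.filter fun i : Fin (m + 1) → Fin N => IsContributing ε i).card : ℝ) ≤
      2 ^ ((m + 1) * (m + 1)) * √(N : ℝ) ^ (m + 2) := by
  set S := Finset.univ.filter fun i : Fin (m + 1) → Fin N => IsContributing ε i with hS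
  let pat : (Fin (m + 1) → Fin N) → Fin (m + 1) → Fin (m + 1) → Bool :=
    fun i k l => decide (i (rowPos ε k) = i (rowPos ε l))
  have hsqrt : (1 : ℝ) ≤ √(N : ℝ) := Real.one_le_sqrt.2 (by exact_mod_cast hN)
  have hfib : ∀ i ∈ S, ((S.filter fun j => pat j = pat i).card : ℝ) ≤ √(N : ℝ) ^ (m + 2) := by
    intro i hi
    have hi' : IsContributing ε i := (Finset.mem_filter.1 hi).2
    have h1 := card_le_pow_finrank (solutionSpace ε i)
      (f := fun v : Fin N => ((v : ℕ) : ℚ) + 1)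
      (fun v w h => by simpa [Fin.ext_iff] using h) (S.filter fun j => pat j = pat i) (by
        intro j hj
        obtain ⟨hj, hp⟩ := Finset.mem_filter.1 hj
        refine mem_solutionSpace_of_isContributing ε (fun k l => ?_) (Finset.mem_filter.1 hj).2
        have := congrFun (congrFun hp k) l
        simpa [pat] using this.symm)
    calc ((S.filter fun j => pat j = pat i).card : ℝ)
        ≤ (N : ℝ) ^ finrank ℚ (solutionSpace ε i) := by exact_mod_cast h1
      _ = √(N : ℝ) ^ (2 * finrank ℚ (solutionSpace ε i)) := by
          rw [pow_mul, Real.sq_sqrt (Nat.cast_nonneg N)]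
      _ ≤ √(N : ℝ) ^ (m + 2) :=
          pow_le_pow_right₀ hsqrt (two_mul_finrank_solutionSpace_le hi')
  have himg : ((S.image pat).card : ℝ) ≤ 2 ^ ((m + 1) * (m + 1)) := by
    have := Finset.card_le_univ (S.image pat)
    simp only [Fintype.card_pi, Fintype.card_bool, Finset.prod_const, Finset.card_univ,
      Fintype.card_fin, ← pow_mul] at this
    exact_mod_cast this
  rw [Finset.card_eq_sum_card_image pat S, Nat.cast_sum]
  calc ∑ p ∈ S.image pat, ((S.filter fun j => pat j = p).card : ℝ)
      ≤ ∑ p ∈ S.image pat, √(N : ℝ) ^ (m + 2) := by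
        refine Finset.sum_le_sum fun p hp => ?_
        obtain ⟨i, hi, rfl⟩ := Finset.mem_image.1 hp
        exact hfib i hi
    _ = (S.image pat).card * √(N : ℝ) ^ (m + 2) := by simp
    _ ≤ _ := by gcongr

end Counting

/-! ### Orthogonality of characters and centered products of them. -/

section Characters

instance isProbabilityMeasure_uniformCircle : IsProbabilityMeasure uniformCircle :=
  ⟨by simpa [uniformCircle] using
    Measure.haarMeasure_self (K₀ := (⊤ : TopologicalSpace.PositiveCompacts Circle))⟩

instance isMulLeftInvariant_uniformCircle : uniformCircle.IsMulLeftInvariant := by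
  unfold uniformCircle
  infer_instance

theorem integral_zpow_uniformCircle (k : ℤ) :
    ∫ z, (z : ℂ) ^ k ∂uniformCircle = if k = 0 then 1 else 0 := by
  split_ifs with hk
  · simp [hk]
  -- Rotation by π/k changes the sign of z^k, so its integral equals its own negative.
  · have hw : ((Circle.exp (Real.pi / k) : Circle) : ℂ) ^ k = -1 := by
      rw [Circle.coe_exp, ← Complex.exp_int_mul, ← Complex.exp_pi_mul_I]
      congr 1
      have : (k : ℂ) ≠ 0 := by exact_mod_cast hk
      push_cast
      field_simp
    have h := integral_mul_left_eq_self (μ := uniformCircle) (fun z : Circle => (z : ℂ) ^ k)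
      (Circle.exp (Real.pi / k))
    simp only [Circle.coe_mul, mul_zpow, hw, neg_mul, one_mul] at h
    rw [integral_neg] at h
    linear_combination (-1 / 2 : ℂ) * h

/-- Bounded measurable complex functions. -/
def IsBoundedMeasurable {Ω : Type*} [MeasurableSpace Ω] (f : Ω → ℂ) : Prop :=
  Measurable f ∧ ∃ B : ℝ, ∀ ω, ‖f ω‖ ≤ B

variable {Ω : Type*} [MeasurableSpace Ω]

theorem isBoundedMeasurable_const (c : ℂ) : IsBoundedMeasurable fun _ : Ω => c :=
  ⟨measurable_const, ‖c‖, fun _ => le_rfl⟩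

theorem IsBoundedMeasurable.mul {f g : Ω → ℂ} (hf : IsBoundedMeasurable f)
    (hg : IsBoundedMeasurable g) : IsBoundedMeasurable fun ω => f ω * g ω := by
  obtain ⟨hf, B, hB⟩ := hf
  obtain ⟨hg, D, hD⟩ := hg
  refine ⟨hf.mul hg, B * D, fun ω => ?_⟩
  rw [norm_mul]
  exact mul_le_mul (hB ω) (hD ω) (norm_nonneg _) ((norm_nonneg _).trans (hB ω))

theorem IsBoundedMeasurable.sub {f g : Ω → ℂ} (hf : IsBoundedMeasurable f)
    (hg : IsBoundedMeasurable g) : IsBoundedMeasurable fun ω => f ω - g ω := by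
  obtain ⟨hf, B, hB⟩ := hf
  obtain ⟨hg, D, hD⟩ := hg
  exact ⟨hf.sub hg, B + D, fun ω => (norm_sub_le _ _).trans (add_le_add (hB ω) (hD ω))⟩

theorem IsBoundedMeasurable.prod {κ : Type*} {f : κ → Ω → ℂ} (s : Finset κ)
    (hf : ∀ k ∈ s, IsBoundedMeasurable (f k)) : IsBoundedMeasurable fun ω => ∏ k ∈ s, f k ω := by
  classical
  induction s using Finset.induction_on with
  | empty => simpa using isBoundedMeasurable_const 1
  | insert a s ha ih =>
    simp only [Finset.prod_insert ha]
    exact (hf a (by simp)).mul (ih fun k hk => hf k (by simp [hk]))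

theorem IsBoundedMeasurable.integrable {f : Ω → ℂ} (hf : IsBoundedMeasurable f) (P : Measure Ω)
    [IsProbabilityMeasure P] : Integrable f P := by
  obtain ⟨hf, B, hB⟩ := hf
  exact Integrable.of_bound hf.aestronglyMeasurable B (Filter.Eventually.of_forall hB)

/-- The Laurent monomial with exponents `a` in the variables `z`. -/
noncomputable def character {N : ℕ} (z : Fin N → Circle) (a : Fin N → ℤ) : ℂ := ∏ v, (z v : ℂ) ^ a v

theorem character_zero {N : ℕ} (z : Fin N → Circle) : character z 0 = 1 := by
  simp [character]

theorem character_add {N : ℕ} (z : Fin N → Circle) (a b : Fin N → ℤ) :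
    character z (a + b) = character z a * character z b := by
  simp only [character, Pi.add_apply]
  rw [← Finset.prod_mul_distrib]
  exact Finset.prod_congr rfl fun v _ => zpow_add₀ (Circle.coe_ne_zero _) _ _

theorem character_sum {N : ℕ} (z : Fin N → Circle) {κ : Type*} (s : Finset κ)
    (a : κ → Fin N → ℤ) : character z (∑ k ∈ s, a k) = ∏ k ∈ s, character z (a k) := by
  classical
  induction s using Finset.induction_on with
  | empty => simp [character_zero]
  | insert k s hk ih => rw [Finset.sum_insert hk, Finset.prod_insert hk, character_add, ih]

theorem norm_character {N : ℕ} (z : Fin N → Circle) (a : Fin N → ℤ) : ‖character z a‖ = 1 := by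
  simp [character, norm_prod, norm_zpow, Circle.norm_coe]

theorem measurable_coe_zpow {f : Ω → Circle} (hf : Measurable f) (k : ℤ) :
    Measurable fun ω => (f ω : ℂ) ^ k := by
  have h : Continuous fun z : Circle => ((z ^ k : Circle) : ℂ) :=
    continuous_induced_dom.comp (continuous_zpow k)
  simpa [Function.comp_def] using h.measurable.comp hf

variable {N : ℕ} {P : Measure Ω} {ζ : Fin N → Ω → Circle}

theorem isBoundedMeasurable_character (hζ : ∀ v, Measurable (ζ v)) (a : Fin N → ℤ) :
    IsBoundedMeasurable fun ω => character (fun v => ζ v ω) a :=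
  ⟨Finset.measurable_fun_prod _ fun v _ => measurable_coe_zpow (hζ v) (a v), 1,
    fun _ => (norm_character _ _).le⟩

theorem integral_character (hζ : ∀ v, Measurable (ζ v)) (hind : iIndepFun ζ P)
    (hlaw : ∀ v, P.map (ζ v) = uniformCircle) (a : Fin N → ℤ) :
    ∫ ω, character (fun v => ζ v ω) a ∂P = if a = 0 then 1 else 0 := by
  have hm : ∀ v, Measurable fun z : Circle => (z : ℂ) ^ a v :=
    fun v => measurable_coe_zpow measurable_id (a v)
  have h := hind.integral_fun_prod_comp (f := fun v (z : Circle) => (z : ℂ) ^ a v)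
    (fun v => (hζ v).aemeasurable) (fun v => (hm v).aestronglyMeasurable)
  have h1 : ∀ v, ∫ ω, (ζ v ω : ℂ) ^ a v ∂P = if a v = 0 then 1 else 0 := by
    intro v
    rw [← integral_zpow_uniformCircle, ← hlaw v, integral_map (hζ v).aemeasurable
      (hm v).aestronglyMeasurable]
  simp only [character]
  rw [h, Finset.prod_congr rfl fun v _ => h1 v]
  split_ifs with ha
  · simp [ha]
  · obtain ⟨v, hv⟩ : ∃ v, a v ≠ 0 := by
      by_contra! h'
      exact ha (funext h')
    exact Finset.prod_eq_zero (Finset.mem_univ v) (by simp [hv])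

variable [IsProbabilityMeasure P]

open Classical in
theorem integral_prod_character_sub_eq_zero (hζ : ∀ v, Measurable (ζ v)) (hind : iIndepFun ζ P)
    (hlaw : ∀ v, P.map (ζ v) = uniformCircle) {κ : Type*} (s : Finset κ) (a : κ → Fin N → ℤ)
    (δ : κ → Prop) (h : (∑ k ∈ s, a k) ≠ 0 ∨ ∃ k ∈ s, a k = 0 ∧ δ k) :
    ∫ ω, ∏ k ∈ s, (character (fun v => ζ v ω) (a k) - if a k = 0 ∧ δ k then 1 else 0) ∂P = 0 := by
  rcases h with h | ⟨k, hk, h0, hδ⟩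
  · have hexp : ∀ ω, ∏ k ∈ s, (character (fun v => ζ v ω) (a k) -
        if a k = 0 ∧ δ k then 1 else 0) = ∑ t ∈ s.powerset,
          character (fun v => ζ v ω) (∑ k ∈ t, a k) *
            ∏ k ∈ s \ t, -(if a k = 0 ∧ δ k then (1 : ℂ) else 0) := by
      intro ω
      simp only [sub_eq_add_neg, Finset.prod_add, character_sum]
    simp only [hexp]
    rw [integral_finsetSum _ fun t _ => ((isBoundedMeasurable_character hζ _).mul
      (isBoundedMeasurable_const _)).integrable P]
    refine Finset.sum_eq_zero fun t ht => ?_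
    rw [integral_mul_const, integral_character hζ hind hlaw]
    -- A surviving term needs zero exponents outside `t` and zero sum over `t`, hence zero total,
    -- contrary to `h`.
    by_cases h1 : ∀ k ∈ s \ t, a k = 0
    · rw [if_neg, zero_mul]
      rwa [← Finset.sum_sdiff (Finset.mem_powerset.1 ht), Finset.sum_eq_zero h1, zero_add] at h
    · push Not at h1
      obtain ⟨k, hk, hk0⟩ := h1
      rw [Finset.prod_eq_zero hk (by simp [hk0]), mul_zero]
  · have : ∀ ω, ∏ k ∈ s, (character (fun v => ζ v ω) (a k) -
        if a k = 0 ∧ δ k then 1 else 0) = 0 := fun ω =>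
      Finset.prod_eq_zero hk (by simp [h0, hδ, character_zero])
    simp [this]

open Classical in
theorem norm_integral_prod_character_sub_le {κ : Type*} (s : Finset κ) (a : κ → Fin N → ℤ)
    (δ : κ → Prop) :
    ‖∫ ω, ∏ k ∈ s, (character (fun v => ζ v ω) (a k) - if a k = 0 ∧ δ k then 1 else 0) ∂P‖ ≤
      2 ^ s.card := by
  have h : ∀ ω, ‖∏ k ∈ s, (character (fun v => ζ v ω) (a k) -
      if a k = 0 ∧ δ k then 1 else 0)‖ ≤ 2 ^ s.card := by
    intro ω
    rw [norm_prod, ← Finset.prod_const]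
    refine Finset.prod_le_prod (fun _ _ => norm_nonneg _) fun k _ => ?_
    refine (norm_sub_le _ _).trans ?_
    rw [norm_character]
    split_ifs <;> norm_num
  simpa using norm_integral_le_of_norm_le_const (μ := P) (Filter.Eventually.of_forall h)

end Characters

/-! ### Ordered products of sums over edge labels. -/

section Expansion

variable {κ Y R : Type*} [DecidableEq κ]

theorem mem_foldr_union {α : Type*} {S : α → Finset κ} {l : List α} {k : κ} :
    k ∈ (l.map S).foldr (· ∪ ·) ∅ ↔ ∃ a ∈ l, k ∈ S a := by
  induction l with
  | nil => simp
  | cons a l ih => simp [ih]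

variable [Fintype κ] [Fintype Y]

/-- The sum over all functions that take the value `y₀` outside `A`. -/
def sumOver [AddCommMonoid R] (y₀ : Y) (A : Finset κ) (G : (κ → Y) → R) : R :=
  ∑ e ∈ Fintype.piFinset fun k => if k ∈ A then Finset.univ else {y₀}, G e

theorem mem_piFinset_ite {y₀ : Y} {A : Finset κ} {e : κ → Y} :
    (e ∈ Fintype.piFinset fun k => if k ∈ A then Finset.univ else {y₀}) ↔
      ∀ k ∉ A, e k = y₀ := by
  rw [Fintype.mem_piFinset]
  refine forall_congr' fun k => ?_
  by_cases h : k ∈ A <;> simp [h]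

theorem sumOver_univ [AddCommMonoid R] (y₀ : Y) (G : (κ → Y) → R) :
    sumOver y₀ Finset.univ G = ∑ e, G e := by
  rw [sumOver]
  refine Finset.sum_congr ?_ fun _ _ => rfl
  ext e
  simp

theorem sumOver_singleton [AddCommMonoid R] (y₀ : Y) (k : κ) (G : Y → R) :
    sumOver y₀ {k} (fun e => G (e k)) = ∑ y, G y := by
  refine Finset.sum_nbij' (fun e => e k) (fun y => Function.update (fun _ => y₀) k y)
    (by simp) ?_ ?_ (by simp) (by simp)
  · intro y _
    rw [mem_piFinset_ite]
    intro l hl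
    rw [Function.update_of_ne (by simpa using hl)]
  · intro e he
    rw [mem_piFinset_ite] at he
    ext l
    by_cases hl : l = k
    · simp [hl]
    · rw [Function.update_of_ne hl, he l (by simpa using hl)]

theorem sumOver_union [NonUnitalNonAssocSemiring R] (y₀ : Y) {A B : Finset κ} (hAB : Disjoint A B)
    {F G : (κ → Y) → R} (hF : ∀ e e', (∀ k ∈ A, e k = e' k) → F e = F e')
    (hG : ∀ e e', (∀ k ∈ B, e k = e' k) → G e = G e') :
    sumOver y₀ (A ∪ B) (fun e => F e * G e) = sumOver y₀ A F * sumOver y₀ B G := by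
  rw [sumOver, sumOver, sumOver, Finset.sum_mul_sum, ← Finset.sum_product']
  have hd : ∀ k ∈ B, k ∉ A := fun k hB hA => Finset.disjoint_left.1 hAB hA hB
  refine Finset.sum_nbij' (fun e => (A.piecewise e fun _ => y₀, B.piecewise e fun _ => y₀))
    (fun p => A.piecewise p.1 p.2) ?_ ?_ ?_ ?_ ?_
  · intro e _
    rw [Finset.mem_product, mem_piFinset_ite, mem_piFinset_ite]
    exact ⟨fun k hk => by simp [hk], fun k hk => by simp [hk]⟩
  · intro p hp
    rw [Finset.mem_product, mem_piFinset_ite, mem_piFinset_ite] at hp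
    rw [mem_piFinset_ite]
    intro k hk
    rw [Finset.mem_union, not_or] at hk
    simp [hk.1, hp.2 k hk.2]
  · intro e he
    rw [mem_piFinset_ite] at he
    ext k
    by_cases hA : k ∈ A
    · simp [hA]
    · by_cases hB : k ∈ B
      · simp [hA, hB]
      · simp [hA, hB, he k (by simp [hA, hB])]
  · intro p hp
    rw [Finset.mem_product, mem_piFinset_ite, mem_piFinset_ite] at hp
    refine Prod.ext (funext fun k => ?_) (funext fun k => ?_)
    · by_cases hA : k ∈ A
      · simp [hA]
      · simp [hA, hp.1 k hA]
    · by_cases hB : k ∈ B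
      · simp [hB, hd k hB]
      · simp [hB, hp.2 k hB]
  · intro e _
    congr 1
    · exact hF _ _ fun k hk => by simp [hk]
    · exact hG _ _ fun k hk => by simp [hk]

/-- Pinning unused labels to `y₀` lets every factor be a sum over the same function type, so
noncommutative distributivity over disjoint label sets keeps the order of the factors. -/
theorem prod_map_sumOver [Semiring R] (y₀ : Y) {α : Type*} (S : α → Finset κ)
    (F : α → (κ → Y) → R) (hF : ∀ a e e', (∀ k ∈ S a, e k = e' k) → F a e = F a e')
    (l : List α) (hl : l.Pairwise fun a b => Disjoint (S a) (S b)) :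
    (l.map fun a => sumOver y₀ (S a) (F a)).prod =
      sumOver y₀ ((l.map S).foldr (· ∪ ·) ∅) fun e => (l.map fun a => F a e).prod := by
  induction l with
  | nil =>
    have : (Fintype.piFinset fun _ : κ => ({y₀} : Finset Y)) = {fun _ => y₀} := by
      ext e; simp [funext_iff]
    simp [sumOver, this]
  | cons a l ih =>
    rw [List.pairwise_cons] at hl
    simp only [List.map_cons, List.prod_cons, List.foldr_cons]
    rw [ih hl.2, sumOver_union]
    · rw [Finset.disjoint_left]
      intro k hk hk'
      obtain ⟨b, hb, hkb⟩ := mem_foldr_union.1 hk'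
      exact Finset.disjoint_left.1 (hl.1 b hb) hk hkb
    · exact hF a
    · intro e e' h
      refine congrArg List.prod (List.map_congr_left fun b hb => hF b e e' fun k hk => ?_)
      exact h k (mem_foldr_union.2 ⟨b, hb, hk⟩)

theorem prod_map_smul {α : Type*} {ι : Type*} [Fintype ι] [DecidableEq ι] (l : List α) (c : α → ℂ)
    (M : α → Matrix ι ι ℂ) :
    (l.map fun a => c a • M a).prod = (l.map c).prod • (l.map M).prod := by
  induction l with
  | nil => simp
  | cons a l ih => simp [ih, smul_smul, mul_comm]

end Expansion

/-! ### Products of matrix units along edges. -/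

section MatrixUnits

variable {ι : Type*} [Fintype ι] [DecidableEq ι]

/-- The matrix unit attached to an edge. -/
def edgeUnit (y : ι × ι) : Matrix ι ι ℂ := Matrix.single y.1 y.2 1

open Classical in
theorem prod_map_edgeUnit {l : List (ι × ι)} (hl : l ≠ []) :
    (l.map edgeUnit).prod =
      if l.IsChain (fun a b : ι × ι => a.2 = b.1) then
        Matrix.single (l.head hl).1 (l.getLast hl).2 1 else 0 := by
  induction l with
  | nil => exact absurd rfl hl
  | cons y l ih =>
    cases l with
    | nil => simp [edgeUnit]
    | cons z l =>
      have hc : (y :: z :: l).IsChain (fun a b : ι × ι => a.2 = b.1) ↔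
          y.2 = z.1 ∧ (z :: l).IsChain (fun a b : ι × ι => a.2 = b.1) :=
        List.isChain_cons_cons (R := fun a b : ι × ι => a.2 = b.1)
      rw [List.map_cons, List.prod_cons, ih (List.cons_ne_nil z l)]
      simp only [hc, List.head_cons, List.getLast_cons_cons]
      by_cases h1 : (z :: l).IsChain (fun a b : ι × ι => a.2 = b.1)
      · by_cases hyz : y.2 = z.1
        · rw [if_pos h1, if_pos ⟨hyz, h1⟩, edgeUnit, hyz]
          simp
        · rw [if_pos h1, if_neg (fun h => hyz h.1), edgeUnit,
            Matrix.single_mul_single_of_ne _ _ _ _ hyz]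
      · rw [if_neg h1, if_neg (fun h => h1 h.2), mul_zero]

theorem matrix_eq_sum_edgeUnit (A : Matrix ι ι ℂ) :
    A = ∑ y : ι × ι, A y.1 y.2 • edgeUnit y := by
  rw [Fintype.sum_prod_type]
  simpa [edgeUnit, Matrix.smul_single] using Matrix.matrix_eq_sum_single A

variable {m : ℕ}

/-- The product of the matrix units along the letters in `J`. -/
def edgeProd (e : Fin (m + 1) → ι × ι) (J : Finset (Fin (m + 1))) : Matrix ι ι ℂ :=
  (J.sort.map fun k => edgeUnit (e k)).prod

theorem edgeProd_eq_or (e : Fin (m + 1) → ι × ι) {J : Finset (Fin (m + 1))} (hJ : J.Nonempty) :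
    edgeProd e J = 0 ∨
      edgeProd e J = Matrix.single (e (J.min' hJ)).1 (e (J.max' hJ)).2 1 := by
  classical
  have hne : J.sort ≠ [] := by
    intro h
    have := Finset.sort_toFinset (s := J) (r := (· ≤ ·))
    rw [h] at this
    exact hJ.ne_empty this.symm
  have hmin : J.min' hJ = J.sort.head hne := by
    rw [Finset.min'_eq_sorted_zero, List.head_eq_getElem]
  have hmax : J.max' hJ = J.sort.getLast hne := by
    rw [Finset.max'_eq_sorted_last, List.getLast_eq_getElem]
  have h := prod_map_edgeUnit (l := J.sort.map e) (by simpa using hne)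
  rw [List.map_map, List.head_map, List.getLast_map, ← hmin, ← hmax] at h
  change edgeProd e J = _ at h
  rw [h]
  split_ifs
  · exact Or.inr rfl
  · exact Or.inl rfl

/-- The product is zero or a single matrix unit, so taking the diagonal only tests whether its ends
agree; this is the source of the end condition in `IsContributing`. -/
theorem diagonal_edgeProd (e : Fin (m + 1) → ι × ι) {J : Finset (Fin (m + 1))}
    (hJ : J.Nonempty) :
    (Matrix.diagonal fun i => edgeProd e J i i) =
      (if (e (J.min' hJ)).1 = (e (J.max' hJ)).2 then (1 : ℂ) else 0) • edgeProd e J := by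
  rcases edgeProd_eq_or e hJ with h | h
  · rw [h]; ext i j; simp [Matrix.diagonal]
  · rw [h]
    ext i j
    simp only [Matrix.diagonal_apply, Matrix.single_apply, Matrix.smul_apply]
    split_ifs <;> simp_all

theorem trace_edgeProd_univ (e : Fin (m + 1) → ι × ι) :
    ‖(edgeProd e Finset.univ).trace‖ ≤ 1 ∧
      ((edgeProd e Finset.univ).trace ≠ 0 → ∀ k, (e k).2 = (e (k + 1)).1) := by
  classical
  have hs : edgeProd e Finset.univ = ((List.ofFn e).map edgeUnit).prod := by
    rw [edgeProd, Fin.sort_univ, List.ofFn_eq_map, List.map_map]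
    rfl
  have hne : List.ofFn e ≠ [] := by simp
  have hhead : (List.ofFn e).head hne = e 0 := by
    rw [List.head_ofFn]
    rfl
  have hlast : (List.ofFn e).getLast hne = e (Fin.last m) := by
    rw [List.getLast_ofFn]
    rfl
  rw [hs, prod_map_edgeUnit hne, hhead, hlast]
  split_ifs with hch
  · constructor
    · by_cases h : (e 0).1 = (e (Fin.last m)).2
      · rw [h, Matrix.trace_single_eq_same]; simp
      · rw [Matrix.trace_single_eq_of_ne _ _ _ h]; simp
    · intro htr k
      have hclosed : (e 0).1 = (e (Fin.last m)).2 := by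
        by_contra h
        exact htr (Matrix.trace_single_eq_of_ne _ _ _ h)
      rw [List.isChain_ofFn] at hch
      rcases eq_or_ne k (Fin.last m) with rfl | hk
      · rw [Fin.last_add_one, hclosed]
      · have hk' : (k : ℕ) < m := Fin.val_lt_last hk
        refine (hch k (by omega)).trans ?_
        congr 2
        apply Fin.ext
        rw [Fin.val_add_one, if_neg hk]
  · simp

end MatrixUnits

/-! ### Expansion of the centered product over walks. -/

section CenteredProduct

variable {m : ℕ}

theorem prod_map_sort (J : Finset (Fin (m + 1))) (f : Fin (m + 1) → ℂ) :
    (J.sort.map f).prod = ∏ k ∈ J, f k := by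
  rw [← List.prod_toFinset f (J.sort_nodup (· ≤ ·)), Finset.sort_toFinset]

theorem disjoint_part_of_ne (ε : Fin (m + 1) → Bool) {s t : Fin (m + 1)}
    (hs : s ∈ blockStarts (maxAltPartition ε)) (ht : t ∈ blockStarts (maxAltPartition ε))
    (hst : s ≠ t) : Disjoint ((maxAltPartition ε).part s) ((maxAltPartition ε).part t) := by
  rw [Finset.disjoint_left]
  intro k hks hkt
  have h := (part_eq_of_mem ε hks).symm.trans (part_eq_of_mem ε hkt)
  exact hst (le_antisymm (mem_blockStarts.1 hs t (h ▸ mem_part_self ε t))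
    (mem_blockStarts.1 ht s (h ▸ mem_part_self ε s)))

theorem biUnion_blockStarts (ε : Fin (m + 1) → Bool) :
    (blockStarts (maxAltPartition ε)).biUnion (maxAltPartition ε).part = Finset.univ := by
  ext k
  obtain ⟨s, hs, hk⟩ := exists_blockStart ε k
  simp only [Finset.mem_biUnion, Finset.mem_univ, iff_true]
  exact ⟨s, hs, hk⟩

theorem pairwise_disjoint_sort_blockStarts (ε : Fin (m + 1) → Bool) :
    (blockStarts (maxAltPartition ε)).sort.Pairwise fun s t =>
      Disjoint ((maxAltPartition ε).part s) ((maxAltPartition ε).part t) := by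
  refine List.Pairwise.imp_of_mem ?_ (Finset.sort_nodup _ _)
  intro s t hs ht hst
  exact disjoint_part_of_ne ε ((Finset.mem_sort _).1 hs) ((Finset.mem_sort _).1 ht) hst

/-- Blocks are intervals, so listing them by first element lists the letters in order, and the block
products concatenate to the full word. -/
theorem flatMap_sort_blockStarts (ε : Fin (m + 1) → Bool) :
    ((blockStarts (maxAltPartition ε)).sort.flatMap fun s => ((maxAltPartition ε).part s).sort) =
      List.finRange (m + 1) := by
  have hlt : ∀ J : Finset (Fin (m + 1)), J.sort.Pairwise (· < ·) := fun J =>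
    J.sortedLT_sort.pairwise
  refine List.SortedLT.eq_of_mem_iff ?_ (List.sortedLT_finRange _) ?_
  · rw [List.sortedLT_iff_pairwise, List.pairwise_flatMap]
    refine ⟨fun s _ => hlt _, List.Pairwise.imp_of_mem ?_ (hlt _)⟩
    intro s t hs ht hst x hx y hy
    rw [Finset.mem_sort] at hs ht hx hy
    by_contra hxy
    rw [not_lt] at hxy
    have hty := mem_blockStarts.1 ht y hy
    have htx : t ∈ (maxAltPartition ε).part s :=
      mem_part_of_between ε (mem_part_self ε s) hx hst.le (hty.trans hxy)
    exact Finset.disjoint_left.1 (disjoint_part_of_ne ε hs ht hst.ne) htx (mem_part_self ε t)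
  · intro k
    obtain ⟨s, hs, hk⟩ := exists_blockStart ε k
    simp only [List.mem_flatMap, Finset.mem_sort, List.mem_finRange, iff_true]
    exact ⟨s, hs, hk⟩

theorem prod_map_prod_map {α β M : Type*} [Monoid M] (l : List α) (f : α → List β) (g : β → M) :
    (l.map fun a => ((f a).map g).prod).prod = ((l.flatMap f).map g).prod := by
  induction l with
  | nil => simp
  | cons a l ih => simp [ih]

theorem prod_edgeProd_part {ι : Type*} [Fintype ι] [DecidableEq ι] (ε : Fin (m + 1) → Bool)
    (e : Fin (m + 1) → ι × ι) :
    ((blockStarts (maxAltPartition ε)).sort.map fun s =>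
      edgeProd e ((maxAltPartition ε).part s)).prod = edgeProd e Finset.univ := by
  simp only [edgeProd]
  rw [prod_map_prod_map, flatMap_sort_blockStarts, Fin.sort_univ]

theorem min'_part (ε : Fin (m + 1) → Bool) {s : Fin (m + 1)}
    (hs : s ∈ blockStarts (maxAltPartition ε)) :
    ((maxAltPartition ε).part s).min' ⟨s, mem_part_self ε s⟩ = s :=
  le_antisymm (Finset.min'_le _ _ (mem_part_self ε s))
    (mem_blockStarts.1 hs _ (Finset.min'_mem _ _))

variable {N : ℕ} (ε : Fin (m + 1) → Bool) (d : Fin (m + 1) → Matrix (Fin N) (Fin N) ℂ)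

/-- The coefficient of a path in the expansion of the product of the letters in `J`. -/
def pathCoeff (X : Matrix (Fin N) (Fin N) ℂ) (J : Finset (Fin (m + 1)))
    (e : Fin (m + 1) → Fin N × Fin N) : ℂ :=
  ∏ k ∈ J, (d k * starPow X (ε k)) (e k).1 (e k).2

theorem blockWord_eq_sumOver (y₀ : Fin N × Fin N) (X : Matrix (Fin N) (Fin N) ℂ)
    (J : Finset (Fin (m + 1))) :
    blockWord ε d X J = sumOver y₀ J fun e => pathCoeff ε d X J e • edgeProd e J := by
  have h : ∀ k, d k * starPow X (ε k) = sumOver y₀ {k} fun e : Fin (m + 1) → Fin N × Fin N =>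
      (d k * starPow X (ε k)) (e k).1 (e k).2 • edgeUnit (e k) := fun k =>
    (matrix_eq_sum_edgeUnit _).trans (sumOver_singleton y₀ k fun y =>
      (d k * starPow X (ε k)) y.1 y.2 • edgeUnit y).symm
  rw [blockWord, List.map_congr_left fun k _ => h k, prod_map_sumOver]
  · congr 1
    · ext k
      rw [mem_foldr_union]
      simp
    · funext e
      rw [prod_map_smul, prod_map_sort]
      rfl
  · intro k e e' he
    rw [he k (by simp)]
  · refine List.Pairwise.imp ?_ (Finset.sort_nodup _ _)
    intro a b hab
    simpa using hab

variable {Ω : Type*} [MeasurableSpace Ω] {P : Measure Ω} [IsProbabilityMeasure P]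
  {X : Ω → Matrix (Fin N) (Fin N) ℂ}

/-- The coefficient of a path in the expansion of the centered block starting at `s`. -/
noncomputable def centeredCoeff (P : Measure Ω) (X : Ω → Matrix (Fin N) (Fin N) ℂ)
    (s : Fin (m + 1)) (e : Fin (m + 1) → Fin N × Fin N) (ω : Ω) : ℂ :=
  pathCoeff ε d (X ω) ((maxAltPartition ε).part s) e -
    (∫ ω', pathCoeff ε d (X ω') ((maxAltPartition ε).part s) e ∂P) *
      if (e s).1 = (e (blockLast ε s)).2 then 1 else 0

theorem isBoundedMeasurable_pathCoeff
    (hX : ∀ k u v, IsBoundedMeasurable fun ω => (d k * starPow (X ω) (ε k)) u v)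
    (J : Finset (Fin (m + 1))) (e : Fin (m + 1) → Fin N × Fin N) :
    IsBoundedMeasurable fun ω => pathCoeff ε d (X ω) J e :=
  IsBoundedMeasurable.prod J fun k _ => hX k _ _

theorem expDiag_blockWord_eq_sumOver (y₀ : Fin N × Fin N)
    (hX : ∀ k u v, IsBoundedMeasurable fun ω => (d k * starPow (X ω) (ε k)) u v)
    (J : Finset (Fin (m + 1))) :
    (expDiag P fun ω => blockWord ε d (X ω) J) = sumOver y₀ J fun e =>
      (∫ ω, pathCoeff ε d (X ω) J e ∂P) • Matrix.diagonal fun i => edgeProd e J i i := by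
  ext u v
  rw [expDiag, sumOver, Matrix.sum_apply, Matrix.diagonal_apply]
  split_ifs with h
  · subst h
    simp only [Matrix.smul_apply, Matrix.diagonal_apply_eq, smul_eq_mul]
    simp only [blockWord_eq_sumOver ε d y₀, sumOver, Matrix.sum_apply, Matrix.smul_apply,
      smul_eq_mul]
    rw [integral_finsetSum _ fun e _ =>
      ((isBoundedMeasurable_pathCoeff ε d hX J e).integrable P).mul_const _]
    simp only [integral_mul_const]
  · simp [Matrix.diagonal_apply_ne _ h]

theorem centered_block_eq_sumOver (y₀ : Fin N × Fin N)
    (hX : ∀ k u v, IsBoundedMeasurable fun ω => (d k * starPow (X ω) (ε k)) u v)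
    {s : Fin (m + 1)} (hs : s ∈ blockStarts (maxAltPartition ε)) (ω : Ω) :
    blockWord ε d (X ω) ((maxAltPartition ε).part s) -
        (expDiag P fun ω' => blockWord ε d (X ω') ((maxAltPartition ε).part s)) =
      sumOver y₀ ((maxAltPartition ε).part s) fun e =>
        centeredCoeff ε d P X s e ω • edgeProd e ((maxAltPartition ε).part s) := by
  rw [expDiag_blockWord_eq_sumOver ε d y₀ hX, blockWord_eq_sumOver ε d y₀, sumOver, sumOver,
    sumOver, ← Finset.sum_sub_distrib]
  refine Finset.sum_congr rfl fun e _ => ?_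
  rw [diagonal_edgeProd e ⟨s, mem_part_self ε s⟩, min'_part ε hs, smul_smul, ← sub_smul]
  rfl

theorem centeredProd_eq_sum (y₀ : Fin N × Fin N)
    (hX : ∀ k u v, IsBoundedMeasurable fun ω => (d k * starPow (X ω) (ε k)) u v) (ω : Ω) :
    centeredProd P ε d X ω = ∑ e : Fin (m + 1) → Fin N × Fin N,
      (∏ s ∈ blockStarts (maxAltPartition ε), centeredCoeff ε d P X s e ω) •
        edgeProd e Finset.univ := by
  rw [centeredProd, blockList, List.map_map, ← sumOver_univ y₀]
  rw [List.map_congr_left (l := (blockStarts (maxAltPartition ε)).sort (· ≤ ·))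
    (f := (fun I => blockWord ε d (X ω) I - expDiag P fun ω' => blockWord ε d (X ω') I) ∘
      (maxAltPartition ε).part) (g := fun s => sumOver y₀ ((maxAltPartition ε).part s) fun e =>
    centeredCoeff ε d P X s e ω • edgeProd e ((maxAltPartition ε).part s)) fun s hs =>
      centered_block_eq_sumOver ε d y₀ hX ((Finset.mem_sort _).1 hs) ω,
    prod_map_sumOver _ _ _ _ _ (pairwise_disjoint_sort_blockStarts ε)]
  · congr 1
    · ext k
      obtain ⟨s, hs, hk⟩ := exists_blockStart ε k
      simp only [mem_foldr_union, Finset.mem_sort, Finset.mem_univ, iff_true]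
      exact ⟨s, hs, hk⟩
    · funext e
      rw [prod_map_smul, prod_map_sort, prod_edgeProd_part]
  · intro s e e' he
    have h1 : ∀ X, pathCoeff ε d X ((maxAltPartition ε).part s) e =
        pathCoeff ε d X ((maxAltPartition ε).part s) e' := fun X =>
      Finset.prod_congr rfl fun k hk => by rw [he k hk]
    have h2 : edgeProd e ((maxAltPartition ε).part s) =
        edgeProd e' ((maxAltPartition ε).part s) :=
      congrArg List.prod (List.map_congr_left fun k hk => by rw [he k ((Finset.mem_sort _).1 hk)])
    simp only [centeredCoeff, h1, h2, he s (mem_part_self ε s), he _ (blockLast_mem ε s)]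

/-- Edges are summed independently; the trace of their product has modulus at most 1 and vanishes
unless they form a closed walk. -/
theorem norm_integral_normTr_centeredProd_le (hN : 1 ≤ N)
    (hX : ∀ k u v, IsBoundedMeasurable fun ω => (d k * starPow (X ω) (ε k)) u v) :
    ‖∫ ω, normTr (centeredProd P ε d X ω) ∂P‖ ≤ (N : ℝ)⁻¹ * ∑ i : Fin (m + 1) → Fin N,
      ‖∫ ω, ∏ s ∈ blockStarts (maxAltPartition ε),
        centeredCoeff ε d P X s (fun k => (i k, i (k + 1))) ω ∂P‖ := by
  classical
  have hint : ∀ e : Fin (m + 1) → Fin N × Fin N, Integrable (fun ω =>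
      ∏ s ∈ blockStarts (maxAltPartition ε), centeredCoeff ε d P X s e ω) P := fun e =>
    (IsBoundedMeasurable.prod _ fun s _ => (isBoundedMeasurable_pathCoeff ε d hX _ e).sub
      (isBoundedMeasurable_const _)).integrable P
  have h : ∫ ω, normTr (centeredProd P ε d X ω) ∂P =
      (N : ℂ)⁻¹ * ∑ e : Fin (m + 1) → Fin N × Fin N,
        (∫ ω, ∏ s ∈ blockStarts (maxAltPartition ε), centeredCoeff ε d P X s e ω ∂P) *
          (edgeProd e Finset.univ).trace := by
    simp only [normTr, centeredProd_eq_sum ε d (⟨0, hN⟩, ⟨0, hN⟩) hX, Matrix.trace_sum,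
      Matrix.trace_smul, smul_eq_mul]
    rw [integral_const_mul, integral_finsetSum _ fun e _ => (hint e).mul_const _]
    simp only [integral_mul_const]
  rw [h, norm_mul, norm_inv, Complex.norm_natCast]
  refine mul_le_mul_of_nonneg_left ?_ (by positivity)
  refine (norm_sum_le _ _).trans ?_
  set φ : (Fin (m + 1) → Fin N) → Fin (m + 1) → Fin N × Fin N := fun i k => (i k, i (k + 1))
  have hφ : Function.Injective φ := fun i j hij =>
    funext fun k => congrArg Prod.fst (congrFun hij k)
  rw [← Finset.sum_subset (Finset.subset_univ (Finset.univ.map ⟨φ, hφ⟩)), Finset.sum_map]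
  · refine Finset.sum_le_sum fun i _ => ?_
    rw [norm_mul]
    exact mul_le_of_le_one_right (norm_nonneg _) (trace_edgeProd_univ _).1
  · intro e _ he
    rw [norm_eq_zero, mul_eq_zero]
    right
    by_contra htr
    refine he (Finset.mem_map.2 ⟨fun k => (e k).1, Finset.mem_univ _, ?_⟩)
    funext k
    exact Prod.ext rfl ((trace_edgeProd_univ e).2 htr k).symm

end CenteredProduct

/-! ### Specialization to Vandermonde matrices. -/

section Vandermonde

variable {m N : ℕ} (ε : Fin (m + 1) → Bool) {d : Fin (m + 1) → Matrix (Fin N) (Fin N) ℂ}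

theorem norm_apply_le_norm_toEuclideanCLM (A : Matrix (Fin N) (Fin N) ℂ) (u v : Fin N) :
    ‖A u v‖ ≤ ‖Matrix.toEuclideanCLM (𝕜 := ℂ) A‖ := by
  have h := (Matrix.toEuclideanCLM (𝕜 := ℂ) A).le_opNorm (EuclideanSpace.single v 1)
  have h2 := PiLp.norm_apply_le
    (Matrix.toEuclideanCLM (𝕜 := ℂ) A (EuclideanSpace.single v 1)) u
  have h3 : Matrix.toEuclideanCLM (𝕜 := ℂ) A (EuclideanSpace.single v 1) u = A u v := by
    change (A.mulVec (Pi.single v 1)) u = A u v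
    simp
  rw [h3] at h2
  simpa using h2.trans h

theorem isDiag_mul_apply {D : Matrix (Fin N) (Fin N) ℂ} (hD : D.IsDiag)
    (A : Matrix (Fin N) (Fin N) ℂ) (u v : Fin N) : (D * A) u v = D u u * A u v := by
  rw [← hD.diagonal_diag, Matrix.diagonal_mul]
  simp

theorem starPow_vandermonde_apply (z : Fin N → Circle) (i : Fin (m + 1) → Fin N)
    (k : Fin (m + 1)) : starPow (vandermonde z) (ε k) (i k) (i (k + 1)) =
      ((√(N : ℝ) : ℝ) : ℂ)⁻¹ * (z (i (rowPos ε k)) : ℂ) ^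
        (letterSign ε k * ((i (colPos ε k) : ℕ) + 1)) := by
  cases h : ε k
  · simp only [starPow, vandermonde, rowPos, colPos, letterSign, h, Bool.false_eq_true, if_false,
      Matrix.of_apply, one_mul]
    norm_cast
  · simp only [starPow, vandermonde, rowPos, colPos, letterSign, h, if_true,
      Matrix.conjTranspose_apply, Matrix.of_apply, star_mul', star_pow, star_inv₀,
      RCLike.star_def, Complex.conj_ofReal, neg_one_mul, zpow_neg, ← Circle.coe_inv_eq_conj,
      Circle.coe_inv, inv_pow]
    norm_cast

theorem isBoundedMeasurable_letter {Ω : Type*} [MeasurableSpace Ω] {ζ : Fin N → Ω → Circle}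
    (hζ : ∀ v, Measurable (ζ v)) (hd : ∀ k, (d k).IsDiag) (k : Fin (m + 1)) (u v : Fin N) :
    IsBoundedMeasurable fun ω =>
      (d k * starPow (vandermonde fun i => ζ i ω) (ε k)) u v := by
  simp only [isDiag_mul_apply (hd k)]
  refine (isBoundedMeasurable_const _).mul ?_
  have hb : ∀ w (j : ℕ), IsBoundedMeasurable fun ω => (ζ w ω : ℂ) ^ j := fun w j =>
    ⟨by simpa using measurable_coe_zpow (hζ w) j, 1, fun ω => by simp [Circle.norm_coe]⟩
  cases ε k
  · exact (isBoundedMeasurable_const _).mul (hb u _)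
  · obtain ⟨h1, B, hB⟩ := (isBoundedMeasurable_const ((√(N : ℝ) : ℝ) : ℂ)⁻¹).mul
      (hb v ((u : ℕ) + 1))
    refine ⟨Complex.continuous_conj.measurable.comp h1, B, fun ω => ?_⟩
    simpa [starPow, vandermonde] using hB ω

theorem pathCoeff_vandermonde (hd : ∀ k, (d k).IsDiag) (z : Fin N → Circle)
    (i : Fin (m + 1) → Fin N) (J : Finset (Fin (m + 1))) :
    pathCoeff ε d (vandermonde z) J (fun k => (i k, i (k + 1))) =
      (∏ k ∈ J, d k (i k) (i k) * ((√(N : ℝ) : ℝ) : ℂ)⁻¹) *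
        character z (exponentAt ε i J) := by
  have h : character z (exponentAt ε i J) = ∏ k ∈ J, (z (i (rowPos ε k)) : ℂ) ^
      (letterSign ε k * ((i (colPos ε k) : ℕ) + 1) : ℤ) := by
    have hz : ∀ (w : ℂ) (hw : w ≠ 0) (s : Finset (Fin (m + 1))) (f : Fin (m + 1) → ℤ),
        w ^ (∑ k ∈ s, f k) = ∏ k ∈ s, w ^ f k := by
      intro w hw s f
      induction s using Finset.induction_on with
      | empty => simp
      | insert a s ha ih => rw [Finset.sum_insert ha, Finset.prod_insert ha, zpow_add₀ hw, ih]
    rw [← Finset.prod_fiberwise (g := fun k => i (rowPos ε k))]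
    refine Finset.prod_congr rfl fun v _ => ?_
    rw [exponentAt, hz _ (Circle.coe_ne_zero _)]
    exact Finset.prod_congr rfl fun k hk => by rw [(Finset.mem_filter.1 hk).2]
  rw [h, ← Finset.prod_mul_distrib]
  refine Finset.prod_congr rfl fun k _ => ?_
  rw [isDiag_mul_apply (hd k), starPow_vandermonde_apply, mul_assoc]

theorem sum_exponentAt_part (i : Fin (m + 1) → Fin N) :
    ∑ s ∈ blockStarts (maxAltPartition ε), exponentAt ε i ((maxAltPartition ε).part s) =
      exponentAt ε i Finset.univ := by
  ext v
  simp only [Finset.sum_apply, exponentAt, Finset.sum_filter]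
  rw [← Finset.sum_biUnion fun s hs t ht hst => disjoint_part_of_ne ε hs ht hst,
    biUnion_blockStarts]

open Classical in
-- Each letter gives a factor at most N^(-1/2), and each block, of which there are at most m + 1, a
-- centered character of modulus at most 2.
theorem norm_integral_prod_centeredCoeff_le {Ω : Type*} [MeasurableSpace Ω] {P : Measure Ω}
    [IsProbabilityMeasure P] {ζ : Fin N → Ω → Circle} (hζ : ∀ v, Measurable (ζ v))
    (hind : iIndepFun ζ P) (hlaw : ∀ v, P.map (ζ v) = uniformCircle)
    (hd : ∀ k, (d k).IsDiag) (hd1 : ∀ k, ‖Matrix.toEuclideanCLM (𝕜 := ℂ) (d k)‖ ≤ 1)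
    (i : Fin (m + 1) → Fin N) :
    ‖∫ ω, ∏ s ∈ blockStarts (maxAltPartition ε), centeredCoeff ε d P
        (fun ω' => vandermonde fun v => ζ v ω') s (fun k => (i k, i (k + 1))) ω ∂P‖ ≤
      if IsContributing ε i then (√(N : ℝ))⁻¹ ^ (m + 1) * 2 ^ (m + 1) else 0 := by
  set S := blockStarts (maxAltPartition ε)
  set a : Fin (m + 1) → Fin N → ℤ := fun s => exponentAt ε i ((maxAltPartition ε).part s)
  set b : Fin (m + 1) → ℂ := fun k => d k (i k) (i k) * ((√(N : ℝ) : ℝ) : ℂ)⁻¹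
  obtain ⟨δ, hδ⟩ : ∃ δ : Fin (m + 1) → Prop, ∀ s, δ s ↔ i s = i (blockLast ε s + 1) :=
    ⟨_, fun _ => Iff.rfl⟩
  have hcoeff : ∀ s ω, centeredCoeff ε d P (fun ω' => vandermonde fun v => ζ v ω') s
      (fun k => (i k, i (k + 1))) ω = (∏ k ∈ (maxAltPartition ε).part s, b k) *
        (character (fun v => ζ v ω) (a s) - if a s = 0 ∧ δ s then 1 else 0) := by
    intro s ω
    simp only [centeredCoeff, pathCoeff_vandermonde ε hd]
    rw [integral_const_mul, integral_character hζ hind hlaw, mul_sub, mul_assoc]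
    congr 2
    simp only [ite_and, hδ, a]
    split_ifs <;> simp
  have hprod : ∏ s ∈ S, ∏ k ∈ (maxAltPartition ε).part s, b k = ∏ k, b k := by
    rw [← Finset.prod_biUnion fun s hs t ht hst => disjoint_part_of_ne ε hs ht hst,
      biUnion_blockStarts]
  have hb : ∀ k, ‖b k‖ ≤ (√(N : ℝ))⁻¹ := by
    intro k
    simp only [b, norm_mul, norm_inv, Complex.norm_real, Real.norm_eq_abs,
      abs_of_nonneg (Real.sqrt_nonneg _)]
    exact mul_le_of_le_one_left (by positivity)
      ((norm_apply_le_norm_toEuclideanCLM _ _ _).trans (hd1 k))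
  have hcontr : ¬ IsContributing ε i → (∑ s ∈ S, a s) ≠ 0 ∨ ∃ s ∈ S, a s = 0 ∧ δ s := by
    intro hi
    by_contra! h
    refine hi ⟨fun v => ?_, fun s hs h0 hi => h.2 s hs (funext h0) ((hδ s).2 hi)⟩
    rw [← sum_exponentAt_part]
    exact congrFun h.1 v
  clear_value a b
  simp only [hcoeff, Finset.prod_mul_distrib]
  rw [integral_const_mul, hprod, norm_mul]
  split_ifs with hi
  · refine mul_le_mul ?_ ((norm_integral_prod_character_sub_le S a δ).trans ?_) (norm_nonneg _)
      (by positivity)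
    · rw [norm_prod]
      refine (Finset.prod_le_prod (fun _ _ => norm_nonneg _) fun k _ => hb k).trans ?_
      simp
    · have := Finset.card_le_univ S
      rw [Fintype.card_fin] at this
      exact pow_le_pow_right₀ (by norm_num) this
  · rw [integral_prod_character_sub_eq_zero hζ hind hlaw S a δ (hcontr hi), norm_zero, mul_zero]

end Vandermonde

end RandomVandermonde

theorem mainTheorem2 (n : ℕ) (hn : 1 ≤ n) :
    ∃ C : ℝ, ∀ (ε : Fin n → Bool) (N : ℕ), 1 ≤ N →
      ∀ {Ω : Type*} [MeasurableSpace Ω] (P : Measure Ω) [IsProbabilityMeasure P]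
        (ζ : Fin N → Ω → Circle),
        (∀ i, Measurable (ζ i)) → iIndepFun ζ P →
        (∀ i, P.map (ζ i) = RandomVandermonde.uniformCircle) →
        ∀ d : Fin n → Matrix (Fin N) (Fin N) ℂ,
          (∀ k, (d k).IsDiag) → (∀ k, ‖Matrix.toEuclideanCLM (𝕜 := ℂ) (d k)‖ ≤ 1) →
          ‖∫ ω, RandomVandermonde.normTr (RandomVandermonde.centeredProd P ε d
              (fun ω' => RandomVandermonde.vandermonde fun i => ζ i ω') ω) ∂P‖
            ≤ C / √(N : ℝ) := by
  obtain ⟨m, rfl⟩ : ∃ m, n = m + 1 := ⟨n - 1, by omega⟩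
  -- The first factor bounds the centered characters, the second the number of row-coincidence
  -- patterns.
  refine ⟨2 ^ (m + 1) * 2 ^ ((m + 1) * (m + 1)), ?_⟩
  intro ε N hN Ω _ P _ ζ hζ hind hlaw d hd hd1
  classical
  have hpos : 0 < √(N : ℝ) := Real.sqrt_pos.2 (by exact_mod_cast hN)
  refine (RandomVandermonde.norm_integral_normTr_centeredProd_le ε d hN
    (RandomVandermonde.isBoundedMeasurable_letter ε hζ hd)).trans ?_
  calc (N : ℝ)⁻¹ * ∑ i : Fin (m + 1) → Fin N, _
      ≤ (N : ℝ)⁻¹ * ∑ i : Fin (m + 1) → Fin N, if RandomVandermonde.IsContributing ε i then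
          (√(N : ℝ))⁻¹ ^ (m + 1) * 2 ^ (m + 1) else 0 := by
        gcongr with i
        exact RandomVandermonde.norm_integral_prod_centeredCoeff_le ε hζ hind hlaw hd hd1 i
    _ = (N : ℝ)⁻¹ * ((Finset.univ.filter fun i : Fin (m + 1) → Fin N =>
          RandomVandermonde.IsContributing ε i).card *
            ((√(N : ℝ))⁻¹ ^ (m + 1) * 2 ^ (m + 1))) := by
        rw [← Finset.sum_filter, Finset.sum_const, nsmul_eq_mul]
    _ ≤ (N : ℝ)⁻¹ * ((2 ^ ((m + 1) * (m + 1)) * √(N : ℝ) ^ (m + 2)) *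
            ((√(N : ℝ))⁻¹ ^ (m + 1) * 2 ^ (m + 1))) := by
        gcongr
        exact RandomVandermonde.card_isContributing_le ε hN
    _ = _ := by
        rw [show (N : ℝ)⁻¹ = (√(N : ℝ) ^ 2)⁻¹ by rw [Real.sq_sqrt (Nat.cast_nonneg N)]]
        rw [inv_pow]
        field_simp
        ring
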